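/- Let $d\ge 1$, let $\sigma\in\mathbb{C}^{d\times d}$ be a density matrix (positive semidefinite with $\operatorname{tr}\sigma=1$), and let $k,n$ be integers with $1\le k\le n$. Measure each of $n$ copies of $\sigma$ separately with the uniform POVM $\{d\cdot|u\rangle\langle u|\cdot\mathrm{d}u\}$, where $\mathrm{d}u$ is the Haar probability measure on the unit vectors of $\mathbb{C}^d$; that is, the outcomes $u_1,\dots,u_n$ are independent, each with density $u\mapsto d\cdot\langle u|\sigma|u\rangle$ with respect to $\mathrm{d}u$. Put $\widehat\sigma_i=(d+1)\,|u_i\rangle\langle u_i|-I$ and $$Z_k=\frac{1}{n(n-1)\cdots(n-k+1)}\sum_{\text{distinct } i_1,\dots,i_k\in\{1,\dots,n\}}\operatorname{tr}\bigl(\widehat\sigma_{i_1}\widehat\sigma_{i_2}\cdots\widehat\sigma_{i_k}\bigr).$$ Then $Z_k$ is real-valued and square-integrable, it is unbiased, $\mathbb{E}[Z_k]=\operatorname{tr}(\sigma^k)$, and $$\operatorname{Var}[Z_k]\le\frac{1}{\binom nk}\sum_{i=0}^{k-1}\binom{k}{k-i}\binom{n-k}{i}\,6^k\,d^{\,k-i-1}\,\operatorname{tr}(\sigma^{2i}).$$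 If moreover $k\le n/2$, then $$\operatorname{Var}[Z_k]\le\frac{24^k}{d}\sum_{j=0}^{k-1}\Bigl(\frac{kd}{n}\Bigr)^{k-j}\operatorname{tr}(\sigma^{2j}).$$ Here $\sigma^0=I$, so $\operatorname{tr}(\sigma^0)=d$. -/

import Mathlib

open MeasureTheory

namespace QuantumMoment

open scoped ComplexOrder Pointwise

/-- A `d`-dimensional quantum state: a positive semidefinite complex matrix of trace one. -/
def IsDensityMatrix {d : ℕ} (σ : Matrix (Fin d) (Fin d) ℂ) : Prop :=
  σ.PosSemidef ∧ σ.trace = 1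

/-- Unit vectors of `ℂ^d`, with the Euclidean norm. -/
abbrev UnitVector (d : ℕ) : Type := Metric.sphere (0 : EuclideanSpace ℂ (Fin d)) 1

/-- The Haar measure on unit vectors of `ℂ^d`: the surface measure of the unit sphere induced by
Lebesgue measure on `ℂ^d = ℝ^(2d)`, normalized to total mass one. It is the unique probability
measure on the sphere that is invariant under the unitary group, that is, the law of `U e₁` for a
Haar random unitary `U`. -/
noncomputable def haarUnitVector (d : ℕ) : Measure (UnitVector d) :=
  ((volume : Measure (EuclideanSpace ℂ (Fin d))).toSphere Set.univ)⁻¹ •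
    (volume : Measure (EuclideanSpace ℂ (Fin d))).toSphere

instance haarUnitVector_isProbabilityMeasure (d : ℕ) [NeZero d] :
    IsProbabilityMeasure (haarUnitVector d) := by
  constructor
  have h : (volume : Measure (EuclideanSpace ℂ (Fin d))).toSphere Set.univ ≠ 0 := by
    rw [Ne, Measure.measure_univ_eq_zero]
    exact Measure.toSphere_ne_zero _
  simp only [haarUnitVector, Measure.smul_apply, smul_eq_mul]
  exact ENNReal.inv_mul_cancel h (measure_ne_top _ _)

/-- The map induced on unit vectors by a unitary operator of `ℂ^d`. -/
noncomputable def rotate {d : ℕ} (A : EuclideanSpace ℂ (Fin d) ≃ₗᵢ[ℂ] EuclideanSpace ℂ (Fin d))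
    (u : UnitVector d) : UnitVector d :=
  ⟨A u.1, by simp⟩

/-- The Haar measure on unit vectors is invariant under every unitary operator. -/
theorem haarUnitVector_map_rotate {d : ℕ}
    (A : EuclideanSpace ℂ (Fin d) ≃ₗᵢ[ℂ] EuclideanSpace ℂ (Fin d)) :
    (haarUnitVector d).map (rotate A) = haarUnitVector d := by
  have hc : Continuous (rotate A) :=
    (A.continuous.comp continuous_subtype_val).subtype_mk _
  ext s hs
  rw [Measure.map_apply hc.measurable hs]
  simp only [haarUnitVector, Measure.smul_apply]
  rw [Measure.toSphere_apply' _ hs, Measure.toSphere_apply' _ (hc.measurable hs)]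
  have hmp : MeasurePreserving (A : EuclideanSpace ℂ (Fin d) → EuclideanSpace ℂ (Fin d)) :=
    (LinearIsometryEquiv.measurePreserving
      ({ A.toLinearEquiv.restrictScalars ℝ with norm_map' := A.norm_map } :
        EuclideanSpace ℂ (Fin d) ≃ₗᵢ[ℝ] EuclideanSpace ℂ (Fin d)))
  have hpre : Set.Ioo (0 : ℝ) 1 • (Subtype.val '' (rotate A ⁻¹' s)) =
      A ⁻¹' (Set.Ioo (0 : ℝ) 1 • (Subtype.val '' s)) := by
    ext x
    simp only [Set.mem_smul, Set.mem_image, Set.mem_preimage]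
    constructor
    · rintro ⟨r, hr, _, ⟨u, hu, rfl⟩, rfl⟩
      refine ⟨r, hr, _, ⟨rotate A u, hu, rfl⟩, ?_⟩
      exact ((A.toLinearEquiv.restrictScalars ℝ).map_smul r u.1).symm
    · rintro ⟨r, hr, _, ⟨u, hu, rfl⟩, hx⟩
      refine ⟨r, hr, _, ⟨rotate A.symm u, ?_, rfl⟩, ?_⟩
      · have : rotate A (rotate A.symm u) = u := Subtype.ext (A.apply_symm_apply u.1)
        rwa [this]
      · apply A.injective
        rw [← hx]
        have h := (A.toLinearEquiv.restrictScalars ℝ).map_smul r (A.symm u.1)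
        refine h.trans ?_
        exact congrArg (fun y => r • y) (A.apply_symm_apply u.1)
  rw [hpre, hmp.measure_preimage_emb A.toHomeomorph.measurableEmbedding]

/-- The rank-one projector `|u⟩⟨u|`. -/
def ketbra {d : ℕ} (u : UnitVector d) : Matrix (Fin d) (Fin d) ℂ :=
  fun a b => u.1 a * star (u.1 b)

/-- The law of the outcome when one copy of `σ` is measured with the uniform POVM
`{d · |u⟩⟨u| · du}`: by the Born rule its density with respect to the Haar measure is
`u ↦ d · tr(|u⟩⟨u| σ)`. -/
noncomputable def uniformPOVM {d : ℕ} (σ : Matrix (Fin d) (Fin d) ℂ) : Measure (UnitVector d) :=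
  (haarUnitVector d).withDensity
    fun u => ENNReal.ofReal ((d : ℝ) * ((ketbra u * σ).trace).re)

/-- The joint law of the outcomes when each of `n` copies of `σ` is measured separately with the
uniform POVM. -/
noncomputable def outcomeLaw {d : ℕ} (n : ℕ) (σ : Matrix (Fin d) (Fin d) ℂ) :
    Measure (Fin n → UnitVector d) :=
  Measure.pi fun _ => uniformPOVM σ

/-- The single-copy estimator `(d + 1) |u⟩⟨u| - I` of the state. -/
noncomputable def stateEstimator {d : ℕ} (u : UnitVector d) : Matrix (Fin d) (Fin d) ℂ :=
  ((d : ℂ) + 1) • ketbra u - 1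

/-- The estimator `Z_k` as a function of the `n` measurement outcomes: the average, over all
sequences `i` of `k` distinct indices in `[n]`, of the trace of the ordered product of the
single-copy estimators; there are `n (n - 1) ⋯ (n - k + 1)` such sequences. -/
noncomputable def momentEstimator {d : ℕ} (n k : ℕ) (u : Fin n → UnitVector d) : ℂ :=
  (n.descFactorial k : ℂ)⁻¹ *
    ∑ i : Fin k ↪ Fin n, ((List.ofFn fun j : Fin k => stateEstimator (u (i j))).prod).trace

end QuantumMoment

namespace QuantumMoment

open scoped ComplexOrder Pointwise Matrix

attribute [local instance] Matrix.frobeniusNormedRing Matrix.frobeniusNormedAlgebra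

/-! ### Third moments of Haar measure from infinitesimal unitary invariance. -/

section Haar

variable {d : ℕ}

/-! The variance of the U-statistic is a normalized sum of covariances over pairs of injective index
sequences, and each covariance is controlled by the number `m` of indices the two sequences share.
An index occurring in only one of the two sequences can be averaged out: the trace is linear in that
estimator, whose mean is `σ`. What remains are two traces of words in which `m` letters are random
and `k - m` letters equal `σ`. For `m = 0` the covariance vanishes. For `m > 0` the shared letters
may appear in different orders, so the two traces are decoupled by `2xy ≤ x² + y²` and it suffices
to bound the second moment of one trace (`covariance_trace_hybridProd_le`).

That second moment is bounded by removing the random letters one at a time. Writing `X` for the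
single-copy estimator and using Frobenius norms, the two one-copy inequalities are `E |tr (X M)|² ≤
3 ‖M‖²` (`integral_norm_trace_sq_le`), used once to open the trace, and `E ‖P X A‖² ≤ 3 ‖P‖² ‖A‖²`
(`integral_norm_mul_stateEstimator_mul_sq_le`), used for each further random letter. Each use of the
latter splits the powers of `σ` into two norms, which Chebyshev's sum inequality `‖σ ^ a‖² ‖σ ^ b‖²
≤ d ‖σ ^ (a + b)‖²` merges again at the price of a factor `d`. The total is `3 (3 d) ^ (m - 1) tr σ
^ (2 (k - m))`.

Both one-copy inequalities follow from the exact third moments of `|u⟩⟨u|` (`haarMoment_eq_trace`).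
These come from differentiating unitary invariance: the integral is annihilated by commutators, and
summing this relation over matrix units gives a recursion that removes one argument
(`haarMoment_contract`).

Counting the sequences that share `m` indices with a fixed one yields the hypergeometric weights of
the first bound; elementary binomial estimates then give the second. -/

theorem continuous_ketbra : Continuous (ketbra : UnitVector d → Matrix (Fin d) (Fin d) ℂ) := by
  refine continuous_pi fun a => continuous_pi fun b => ?_
  simp only [ketbra]
  fun_prop

theorem trace_ketbra (u : UnitVector d) : (ketbra u).trace = 1 := by
  have h : ‖u.1‖ ^ 2 = 1 := by rw [norm_eq_of_mem_sphere u, one_pow]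
  rw [EuclideanSpace.norm_sq_eq] at h
  have h2 : ∀ a, ketbra u a a = ((‖u.1 a‖ ^ 2 : ℝ) : ℂ) := fun a => by
    simp [ketbra, Complex.mul_conj, Complex.normSq_eq_norm_sq]
  rw [Matrix.trace]
  simp only [Matrix.diag_apply, h2]
  rw [← Complex.ofReal_sum, h, Complex.ofReal_one]

theorem conjTranspose_ketbra (u : UnitVector d) : (ketbra u)ᴴ = ketbra u := by
  ext a b
  simp [ketbra, Matrix.conjTranspose_apply, mul_comm]

/-- A rank-one projector compresses any matrix to a multiple of itself. -/
theorem ketbra_mul_mul_ketbra (u : UnitVector d) (M : Matrix (Fin d) (Fin d) ℂ) :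
    ketbra u * M * ketbra u = (ketbra u * M).trace • ketbra u := by
  ext a b
  simp only [ketbra, Matrix.mul_apply, Matrix.trace, Matrix.diag_apply, Matrix.smul_apply,
    smul_eq_mul, Finset.sum_mul]
  refine Finset.sum_congr rfl fun x _ => Finset.sum_congr rfl fun y _ => ?_
  ring

theorem continuous_integrable {X E : Type*} [TopologicalSpace X] [CompactSpace X]
    [MeasurableSpace X] [OpensMeasurableSpace X] [NormedAddCommGroup E] {μ : Measure X}
    [IsFiniteMeasure μ] {f : X → E} (hf : Continuous f) : Integrable f μ :=
  hf.integrable_of_hasCompactSupport (HasCompactSupport.of_compactSpace f)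

theorem integral_conj_ketbra {E : Type*} [NormedAddCommGroup E] [NormedSpace ℝ E]
    (V : Matrix (Fin d) (Fin d) ℂ) (hV : Vᴴ * V = 1)
    (f : Matrix (Fin d) (Fin d) ℂ → E) (hf : Continuous f) :
    ∫ u, f (V * ketbra u * Vᴴ) ∂(haarUnitVector d) = ∫ u, f (ketbra u) ∂(haarUnitVector d) := by
  have hV' : V * Vᴴ = 1 := mul_eq_one_comm.mp hV
  let T : unitary (EuclideanSpace ℂ (Fin d) →L[ℂ] EuclideanSpace ℂ (Fin d)) :=
    ⟨Matrix.toEuclideanCLM (𝕜 := ℂ) V, by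
      rw [Unitary.mem_iff, ← map_star, ← map_mul, ← map_mul, Matrix.star_eq_conjTranspose, hV, hV',
        map_one]
      exact ⟨rfl, rfl⟩⟩
  let A := Unitary.linearIsometryEquiv T
  have hc : Continuous (rotate A) :=
    (A.continuous.comp continuous_subtype_val).subtype_mk _
  have hA : ∀ u : UnitVector d, ∀ a, (rotate A u).1 a = ∑ b, V a b * u.1 b := fun u a => rfl
  have hk : ∀ u, ketbra (rotate A u) = V * ketbra u * Vᴴ := by
    intro u
    ext a b
    simp only [ketbra, hA, Matrix.mul_apply, Matrix.conjTranspose_apply, star_sum, star_mul',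
      Finset.sum_mul, Finset.mul_sum]
    refine Finset.sum_congr rfl fun x _ => Finset.sum_congr rfl fun y _ => ?_
    ring
  conv_rhs => rw [← haarUnitVector_map_rotate A]
  rw [integral_map (f := fun u => f (ketbra u)) hc.measurable.aemeasurable
    (hf.comp continuous_ketbra).aestronglyMeasurable]
  simp only [hk]

/-- Summing over matrix units fuses the two traces into one trace of a product. The projector `K =
|u⟩⟨u|` has rank one, so `tr (K A K B) = tr (K A) tr (K B)`, and `K² = K` handles the other half of
the commutator. -/
theorem sum_trace_single_mul_commutator (u : UnitVector d) (A B : Matrix (Fin d) (Fin d) ℂ) :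
    ∑ a, ∑ b, (ketbra u * (A * Matrix.single a b 1)).trace *
      (ketbra u * (B * Matrix.single b a 1 - Matrix.single b a 1 * B)).trace
      = (ketbra u * A).trace * (ketbra u * B).trace - (ketbra u * (A * B)).trace := by
  have hE : ∀ (M : Matrix (Fin d) (Fin d) ℂ) a b, (M * Matrix.single a b 1).trace = M b a :=
    fun M a b => by simp [Matrix.trace_mul_single]
  have hE' : ∀ (M N : Matrix (Fin d) (Fin d) ℂ) a b,
      (M * (Matrix.single a b 1 * N)).trace = (N * M) b a := fun M N a b => by
    rw [← mul_assoc, Matrix.trace_mul_comm, ← mul_assoc, hE]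
  simp only [mul_sub, Matrix.trace_sub, ← mul_assoc (ketbra u) _ (Matrix.single _ _ _), hE, hE',
    Finset.sum_sub_distrib]
  congr 1
  · have ht : (ketbra u * A).trace * (ketbra u * B).trace = (ketbra u * A * (ketbra u * B)).trace := by
      rw [← mul_assoc, ketbra_mul_mul_ketbra, Matrix.smul_mul, Matrix.trace_smul, smul_eq_mul]
    rw [ht, Matrix.trace, Finset.sum_comm]
    simp only [Matrix.diag_apply, Matrix.mul_apply (M := ketbra u * A)]
  · have hK : ketbra u * ketbra u = ketbra u := by
      have := ketbra_mul_mul_ketbra u 1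
      rwa [mul_one, trace_ketbra, one_smul] at this
    conv_rhs => rw [← hK, mul_assoc, Matrix.trace_mul_comm, mul_assoc, mul_assoc, ← mul_assoc]
    rw [Matrix.trace, Finset.sum_comm]
    simp only [Matrix.diag_apply, Matrix.mul_apply (M := ketbra u * A)]

/-- The trilinear moment `∫ ⟨u|A|u⟩ ⟨u|B|u⟩ ⟨u|C|u⟩ du`. -/
noncomputable def haarMoment (A B C : Matrix (Fin d) (Fin d) ℂ) : ℂ :=
  ∫ u, (ketbra u * A).trace * (ketbra u * B).trace * (ketbra u * C).trace ∂(haarUnitVector d)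

theorem haarMoment_conj (V A B C : Matrix (Fin d) (Fin d) ℂ) (hV : Vᴴ * V = 1) :
    haarMoment (Vᴴ * A * V) (Vᴴ * B * V) (Vᴴ * C * V) = haarMoment A B C := by
  have h := integral_conj_ketbra V hV
    (fun K => (K * A).trace * (K * B).trace * (K * C).trace) (by fun_prop)
  have ht : ∀ (K M : Matrix (Fin d) (Fin d) ℂ),
      (V * K * Vᴴ * M).trace = (K * (Vᴴ * M * V)).trace := fun K M => by
    rw [mul_assoc, mul_assoc, Matrix.trace_mul_comm]
    simp only [mul_assoc]
  simp only [ht] at h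
  exact h

theorem haarMoment_smul_left (c : ℂ) (A B C : Matrix (Fin d) (Fin d) ℂ) :
    haarMoment (c • A) B C = c * haarMoment A B C := by
  simp only [haarMoment, Matrix.mul_smul, Matrix.trace_smul, smul_eq_mul]
  rw [← integral_const_mul]
  exact integral_congr_ae (Filter.Eventually.of_forall fun u => by ring)

/-- The quadratic form `u ↦ ⟨u|M|u⟩` as a continuous function, depending linearly on `M`. -/
noncomputable def quadraticFormCLM :
    Matrix (Fin d) (Fin d) ℂ →L[ℝ] C(UnitVector d, ℂ) :=
  LinearMap.toContinuousLinearMap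
    { toFun := fun M => ⟨fun u => (ketbra u * M).trace,
        (continuous_ketbra.matrix_mul continuous_const).matrix_trace⟩
      map_add' := fun M N => by ext u; simp [mul_add]
      map_smul' := fun c M => by ext u; simp }

variable [NeZero d]

/-- Integration against the Haar measure as a continuous functional. -/
noncomputable def haarIntegralCLM : C(UnitVector d, ℂ) →L[ℝ] ℂ :=
  LinearMap.mkContinuous
    { toFun := fun f => ∫ u, f u ∂(haarUnitVector d)
      map_add' := fun f g => by
        simp only [ContinuousMap.add_apply]
        exact integral_add (continuous_integrable f.continuous) (continuous_integrable g.continuous)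
      map_smul' := fun c f => by
        simp only [ContinuousMap.smul_apply]
        exact integral_smul c f }
    1 fun f => by
      have := norm_integral_le_of_norm_le_const (μ := haarUnitVector d) (f := f) (C := ‖f‖)
        (Filter.Eventually.of_forall fun u => f.norm_coe_le_norm u)
      simpa using this

theorem haarMoment_eq (A B C : Matrix (Fin d) (Fin d) ℂ) :
    haarMoment A B C = haarIntegralCLM
      (quadraticFormCLM A * quadraticFormCLM B * quadraticFormCLM C) := rfl

theorem haarMoment_add_left (A A' B C : Matrix (Fin d) (Fin d) ℂ) :
    haarMoment (A + A') B C = haarMoment A B C + haarMoment A' B C := by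
  simp only [haarMoment_eq, map_add, add_mul]

theorem haarMoment_add_mid (A B B' C : Matrix (Fin d) (Fin d) ℂ) :
    haarMoment A (B + B') C = haarMoment A B C + haarMoment A B' C := by
  simp only [haarMoment_eq, map_add, add_mul, mul_add]

theorem haarMoment_add_right (A B C C' : Matrix (Fin d) (Fin d) ℂ) :
    haarMoment A B (C + C') = haarMoment A B C + haarMoment A B C' := by
  simp only [haarMoment_eq, map_add, mul_add]

theorem haarMoment_comm_left (A B C : Matrix (Fin d) (Fin d) ℂ) :
    haarMoment A B C = haarMoment B A C := by
  simp only [haarMoment_eq, mul_comm (quadraticFormCLM A)]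

theorem haarMoment_comm_right (A B C : Matrix (Fin d) (Fin d) ℂ) :
    haarMoment A B C = haarMoment A C B := by
  simp only [haarMoment_eq, mul_right_comm]

theorem haarMoment_smul_mid (c : ℂ) (A B C : Matrix (Fin d) (Fin d) ℂ) :
    haarMoment A (c • B) C = c * haarMoment A B C := by
  rw [haarMoment_comm_left, haarMoment_smul_left, haarMoment_comm_left]

theorem haarMoment_smul_right (c : ℂ) (A B C : Matrix (Fin d) (Fin d) ℂ) :
    haarMoment A B (c • C) = c * haarMoment A B C := by
  rw [haarMoment_comm_right, haarMoment_smul_mid, haarMoment_comm_right]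

/-- The moment is constant along conjugation by the unitaries `exp (t K)`; the identity is its
derivative at `t = 0`. Treating quadratic forms as elements of the Banach algebra `C(UnitVector d,
ℂ)`, with integration a continuous functional on it, makes differentiation under the integral a
chain rule. -/
theorem haarMoment_commutator_of_skew (A B C K : Matrix (Fin d) (Fin d) ℂ) (hK : Kᴴ = -K) :
    haarMoment (A * K - K * A) B C + haarMoment A (B * K - K * B) C
      + haarMoment A B (C * K - K * C) = 0 := by
  let V : ℝ → Matrix (Fin d) (Fin d) ℂ := fun t => NormedSpace.exp (t • K)
  let W : ℝ → Matrix (Fin d) (Fin d) ℂ := fun t => NormedSpace.exp (t • (-K))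
  have hVW : ∀ t, (V t)ᴴ = W t := fun t => by
    simp only [V, W]
    rw [← Matrix.exp_conjTranspose, Matrix.conjTranspose_smul, hK, star_trivial]
  have hunit : ∀ t, (V t)ᴴ * V t = 1 := fun t => by
    rw [hVW]
    simp only [V, W]
    rw [← Matrix.exp_add_of_commute]
    · simp
    · simp
  have hV0 : V 0 = 1 := by simp [V]
  have hW0 : W 0 = 1 := by simp [W]
  have hV : HasDerivAt V K 0 := by
    have := hasDerivAt_exp_smul_const (𝕂 := ℝ) K 0
    rw [zero_smul, NormedSpace.exp_zero, one_mul] at this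
    exact this
  have hW : HasDerivAt W (-K) 0 := by
    have := hasDerivAt_exp_smul_const (𝕂 := ℝ) (-K) 0
    rw [zero_smul, NormedSpace.exp_zero, one_mul] at this
    exact this
  have hM : ∀ M, HasDerivAt (fun t => quadraticFormCLM (W t * M * V t))
      (quadraticFormCLM (M * K - K * M)) 0 := fun M => by
    have h := (hW.mul_const M).mul hV
    rw [hV0, hW0] at h
    have h2 := (quadraticFormCLM (d := d)).hasFDerivAt.comp_hasDerivAt (0 : ℝ) h
    rw [show -K * M * 1 + 1 * M * K = M * K - K * M by noncomm_ring] at h2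
    exact h2
  have hM0 : ∀ M, W 0 * M * V 0 = M := fun M => by rw [hV0, hW0]; simp
  have hder := (haarIntegralCLM (d := d)).hasFDerivAt.comp_hasDerivAt (0 : ℝ)
    (((hM A).mul (hM B)).mul (hM C))
  have hconst : (haarIntegralCLM (d := d)) ∘ (((fun t => quadraticFormCLM (W t * A * V t)) *
      (fun t => quadraticFormCLM (W t * B * V t))) * fun t => quadraticFormCLM (W t * C * V t))
      = fun _ => haarMoment A B C := by
    funext t
    have := haarMoment_conj (V t) A B C (hunit t)
    rw [hVW] at this
    exact this
  rw [hconst] at hder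
  have h0 := hder.unique (hasDerivAt_const (0 : ℝ) _)
  simp only [hM0, Pi.mul_apply] at h0
  rw [haarMoment_eq, haarMoment_eq, haarMoment_eq, ← map_add, ← map_add, ← add_mul]
  exact h0

/-- Every matrix is a complex combination of the skew-Hermitian matrices `H - Hᴴ` and `i (H + Hᴴ)`,
and the relation is complex linear in `H`. -/
theorem haarMoment_commutator (A B C H : Matrix (Fin d) (Fin d) ℂ) :
    haarMoment (A * H - H * A) B C + haarMoment A (B * H - H * B) C
      + haarMoment A B (C * H - H * C) = 0 := by
  have h1 := haarMoment_commutator_of_skew A B C (H - Hᴴ) (by simp)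
  have h2 := haarMoment_commutator_of_skew A B C (Complex.I • (H + Hᴴ)) (by
    rw [Matrix.conjTranspose_smul]
    simp [add_comm])
  have e : ∀ M : Matrix (Fin d) (Fin d) ℂ, M * H - H * M =
      (1 / 2 : ℂ) • (M * (H - Hᴴ) - (H - Hᴴ) * M) + (-Complex.I / 2) •
        (M * (Complex.I • (H + Hᴴ)) - (Complex.I • (H + Hᴴ)) * M) := fun M => by
    simp only [Matrix.mul_smul, Matrix.smul_mul, ← smul_sub, smul_smul]
    rw [show -Complex.I / 2 * Complex.I = 1 / 2 by
      rw [div_mul_eq_mul_div, neg_mul, Complex.I_mul_I, neg_neg], ← smul_add]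
    rw [show M * (H - Hᴴ) - (H - Hᴴ) * M + (M * (H + Hᴴ) - (H + Hᴴ) * M) =
      (2 : ℂ) • (M * H - H * M) by rw [two_smul]; noncomm_ring, smul_smul]
    norm_num
  rw [e A, e B, e C]
  simp only [haarMoment_add_left, haarMoment_add_mid, haarMoment_add_right, haarMoment_smul_left,
    haarMoment_smul_mid, haarMoment_smul_right]
  linear_combination (1 / 2 : ℂ) * h1 + (-Complex.I / 2) * h2

theorem haarMoment_sum_left {ι : Type*} (s : Finset ι) (A : ι → Matrix (Fin d) (Fin d) ℂ)
    (B C : Matrix (Fin d) (Fin d) ℂ) :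
    haarMoment (∑ i ∈ s, A i) B C = ∑ i ∈ s, haarMoment (A i) B C := by
  simp only [haarMoment_eq, map_sum, Finset.sum_mul]

theorem sum_haarMoment_single_mul_commutator (A B C : Matrix (Fin d) (Fin d) ℂ) :
    ∑ a, ∑ b, haarMoment (A * Matrix.single a b 1)
      (B * Matrix.single b a 1 - Matrix.single b a 1 * B) C
      = haarMoment A B C - haarMoment 1 (A * B) C := by
  have key : ∑ a, ∑ b, (quadraticFormCLM (A * Matrix.single a b 1) *
      quadraticFormCLM (B * Matrix.single b a 1 - Matrix.single b a 1 * B))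
      = quadraticFormCLM A * quadraticFormCLM B -
        quadraticFormCLM 1 * quadraticFormCLM (A * B) := by
    ext u
    simp only [ContinuousMap.sum_apply, ContinuousMap.mul_apply, ContinuousMap.sub_apply]
    have h1 : ∀ M, quadraticFormCLM M u = (ketbra u * M).trace := fun M => rfl
    simp only [h1]
    rw [sum_trace_single_mul_commutator, mul_one, trace_ketbra, one_mul]
  simp only [haarMoment_eq]
  rw [← map_sub, ← sub_mul, ← key]
  simp only [Finset.sum_mul, map_sum]

/-- Contracting the first factor of a trilinear Haar moment. -/
theorem haarMoment_contract (A B C : Matrix (Fin d) (Fin d) ℂ) :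
    ((d : ℂ) + 2) * haarMoment A B C =
      A.trace * haarMoment 1 B C + haarMoment 1 (A * B) C + haarMoment 1 B (A * C) := by
  -- The Casimir contraction: insert `E_ab` after `A`, commute with `E_ba`, and sum. The first
  -- argument contributes `d A - (tr A) 1`, and each of the other two contributes another copy of
  -- the moment, whence the factor `d + 2`.
  have h : ∑ a, ∑ b, _ = ∑ a : Fin d, ∑ b : Fin d, (0 : ℂ) := Finset.sum_congr rfl fun a _ =>
    Finset.sum_congr rfl fun b _ =>
      haarMoment_commutator (A * Matrix.single a b 1) B C (Matrix.single b a 1)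
  have e3 : ∑ a, ∑ b, haarMoment (A * Matrix.single a b 1) B
      (C * Matrix.single b a 1 - Matrix.single b a 1 * C)
      = haarMoment A B C - haarMoment 1 B (A * C) := by
    simp only [haarMoment_comm_right _ B]
    exact sum_haarMoment_single_mul_commutator A C B
  have e1 : ∑ a : Fin d, ∑ b : Fin d, (A * Matrix.single a b (1 : ℂ) * Matrix.single b a 1
      - Matrix.single b a 1 * (A * Matrix.single a b 1)) = (d : ℂ) • A - A.trace • 1 := by
    have hs : ∀ a b : Fin d, A * Matrix.single a b (1 : ℂ) * Matrix.single b a 1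
        = A * Matrix.single a a 1 := fun a b => by
      rw [mul_assoc, Matrix.single_mul_single_same, mul_one]
    have ht : ∀ a b : Fin d, Matrix.single b a 1 * (A * Matrix.single a b (1 : ℂ))
        = A a a • Matrix.single b b 1 := fun a b => by
      rw [← mul_assoc, Matrix.single_mul_mul_single]
      simp
    simp only [hs, ht, Finset.sum_sub_distrib]
    have h1 : ∑ a : Fin d, Matrix.single a a (1 : ℂ) = 1 := by
      rw [Matrix.sum_single_eq_diagonal]; simp
    congr 1
    · simp only [Finset.sum_const, Finset.card_univ, Fintype.card_fin]
      rw [← Finset.smul_sum, ← Finset.mul_sum, h1, mul_one, Nat.cast_smul_eq_nsmul]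
    · simp only [← Finset.smul_sum, h1, ← Finset.sum_smul]
      rfl
  simp only [Finset.sum_add_distrib, e3, sum_haarMoment_single_mul_commutator,
    ← haarMoment_sum_left, e1, Finset.sum_const_zero] at h
  rw [sub_eq_add_neg, ← neg_smul, haarMoment_add_left, haarMoment_smul_left,
    haarMoment_smul_left] at h
  linear_combination h

theorem haarMoment_one_one_one : haarMoment (1 : Matrix (Fin d) (Fin d) ℂ) 1 1 = 1 := by
  simp [haarMoment, trace_ketbra]

theorem haarMoment_one_one (A : Matrix (Fin d) (Fin d) ℂ) :
    (d : ℂ) * haarMoment 1 1 A = A.trace := by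
  have h := haarMoment_contract A 1 1
  rw [haarMoment_one_one_one, mul_one, mul_one, haarMoment_comm_right 1 A 1, haarMoment_comm_left A,
    haarMoment_comm_right 1 A 1] at h
  linear_combination h

theorem haarMoment_one (A B : Matrix (Fin d) (Fin d) ℂ) :
    (d : ℂ) * ((d : ℂ) + 1) * haarMoment 1 A B = A.trace * B.trace + (A * B).trace := by
  have h := haarMoment_contract A B 1
  rw [haarMoment_comm_right A B 1, haarMoment_comm_left A 1 B, haarMoment_comm_right 1 B 1,
    haarMoment_comm_right 1 (A * B) 1, mul_one, haarMoment_comm_right 1 B A] at h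
  have h1 := haarMoment_one_one B
  have h2 := haarMoment_one_one (A * B)
  linear_combination (d : ℂ) * h + A.trace * h1 + h2

theorem haarMoment_eq_trace (A B C : Matrix (Fin d) (Fin d) ℂ) :
    (d : ℂ) * ((d : ℂ) + 1) * ((d : ℂ) + 2) * haarMoment A B C =
      A.trace * (B.trace * C.trace + (B * C).trace) + (A * B).trace * C.trace
        + (A * B * C).trace + B.trace * (A * C).trace + (B * A * C).trace := by
  have h := haarMoment_contract A B C
  have h1 := haarMoment_one B C
  have h2 := haarMoment_one (A * B) C
  have h3 := haarMoment_one B (A * C)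
  rw [← mul_assoc] at h3
  linear_combination (d : ℂ) * ((d : ℂ) + 1) * h + A.trace * h1 + h2 + h3

end Haar

/-! ### Frobenius norms and moments of a positive semidefinite matrix. -/

section Frobenius

variable {d : ℕ}

theorem frobenius_norm_sq (M : Matrix (Fin d) (Fin d) ℂ) :
    ‖M‖ ^ 2 = ∑ i, ∑ j, ‖M i j‖ ^ 2 := by
  rw [Matrix.frobenius_norm_def]
  simp only [Real.rpow_ofNat]
  rw [← Real.sqrt_eq_rpow, Real.sq_sqrt (by positivity)]

theorem trace_mul_conjTranspose_self (M : Matrix (Fin d) (Fin d) ℂ) :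
    (M * Mᴴ).trace = ((‖M‖ ^ 2 : ℝ) : ℂ) := by
  rw [frobenius_norm_sq]
  simp [Matrix.trace, Matrix.mul_apply, Complex.mul_conj, Complex.normSq_eq_norm_sq]

theorem norm_trace_mul_le (M N : Matrix (Fin d) (Fin d) ℂ) : ‖(M * N).trace‖ ≤ ‖M‖ * ‖N‖ := by
  have hN : ‖N‖ ^ 2 = ∑ i, ∑ j, ‖N j i‖ ^ 2 := by rw [frobenius_norm_sq, Finset.sum_comm]
  have h1 : ‖(M * N).trace‖ ≤ ∑ p : Fin d × Fin d, ‖M p.1 p.2‖ * ‖N p.2 p.1‖ := by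
    rw [Fintype.sum_prod_type]
    simp only [Matrix.trace, Matrix.diag_apply, Matrix.mul_apply]
    refine (norm_sum_le _ _).trans (Finset.sum_le_sum fun i _ => ?_)
    refine (norm_sum_le _ _).trans (Finset.sum_le_sum fun j _ => (norm_mul _ _).le)
  refine h1.trans (abs_le_of_sq_le_sq' ?_ (by positivity)).2
  refine (Finset.sum_mul_sq_le_sq_mul_sq _ _ _).trans (le_of_eq ?_)
  rw [mul_pow, frobenius_norm_sq, hN, Fintype.sum_prod_type, Fintype.sum_prod_type]

theorem trace_pow_of_isHermitian {σ : Matrix (Fin d) (Fin d) ℂ} (h : σ.IsHermitian) (m : ℕ) :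
    (σ ^ m).trace = ((∑ i, h.eigenvalues i ^ m : ℝ) : ℂ) := by
  conv_lhs => rw [h.spectral_theorem]
  rw [← map_pow, Unitary.conjStarAlgAut_apply, Matrix.trace_mul_comm, ← mul_assoc,
    Matrix.diagonal_pow, Unitary.coe_star_mul_self, one_mul, Matrix.trace_diagonal]
  simp

/-- The squared Frobenius norm of `σ ^ m` is the moment of order `2 m`. -/
theorem norm_sq_pow_of_isHermitian {σ : Matrix (Fin d) (Fin d) ℂ} (h : σ.IsHermitian) (m : ℕ) :
    ‖σ ^ m‖ ^ 2 = ((σ ^ (2 * m)).trace).re := by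
  have := trace_mul_conjTranspose_self (σ ^ m)
  rw [Matrix.conjTranspose_pow, h.eq, ← pow_add, ← two_mul] at this
  rw [this, Complex.ofReal_re]

/-- Chebyshev's sum inequality for the even moments of a positive semidefinite matrix. -/
theorem norm_sq_pow_mul_le {σ : Matrix (Fin d) (Fin d) ℂ} (h : σ.PosSemidef) (a b : ℕ) :
    ‖σ ^ a‖ ^ 2 * ‖σ ^ b‖ ^ 2 ≤ d * ‖σ ^ (a + b)‖ ^ 2 := by
  simp only [norm_sq_pow_of_isHermitian h.1, trace_pow_of_isHermitian h.1, Complex.ofReal_re]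
  -- Nonnegative eigenvalues make both families of powers increase with the eigenvalue, hence
  -- similarly ordered.
  have hm : Monovary (fun i => h.1.eigenvalues i ^ (2 * a)) fun i => h.1.eigenvalues i ^ (2 * b) := by
    intro i j hij
    have : h.1.eigenvalues i ≤ h.1.eigenvalues j :=
      (lt_of_pow_lt_pow_left₀ _ (h.eigenvalues_nonneg j) hij).le
    exact pow_le_pow_left₀ (h.eigenvalues_nonneg i) this _
  have := hm.sum_mul_sum_le_card_mul_sum
  simpa only [← pow_add, ← mul_add, Fintype.card_fin] using this

/-- The eigenvalues are nonnegative with sum one, so the sum of their squares is at most one. -/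
theorem IsDensityMatrix.norm_le_one {σ : Matrix (Fin d) (Fin d) ℂ} (hσ : IsDensityMatrix σ) :
    ‖σ‖ ≤ 1 := by
  have h := hσ.1
  have h1 : ∑ i, h.1.eigenvalues i = 1 := by
    have := trace_pow_of_isHermitian h.1 1
    rw [pow_one, hσ.2] at this
    simp only [pow_one] at this
    exact_mod_cast this.symm
  have h2 := norm_sq_pow_of_isHermitian h.1 1
  rw [pow_one, trace_pow_of_isHermitian h.1, Complex.ofReal_re, mul_one] at h2
  have h3 : ∑ i, h.1.eigenvalues i ^ 2 ≤ (∑ i, h.1.eigenvalues i) ^ 2 :=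
    Finset.sum_sq_le_sq_sum_of_nonneg fun i _ => h.eigenvalues_nonneg i
  rw [← h2, h1] at h3
  exact (abs_le_of_sq_le_sq' h3 zero_le_one).2

theorem IsDensityMatrix.neZero {σ : Matrix (Fin d) (Fin d) ℂ} (hσ : IsDensityMatrix σ) :
    NeZero d := by
  refine ⟨?_⟩
  rintro rfl
  have := hσ.2
  simp [Matrix.trace] at this

end Frobenius

/-! ### First and second moments of the single-copy estimator. -/

section POVM

variable {d : ℕ}

theorem trace_ketbra_mul_nonneg {σ : Matrix (Fin d) (Fin d) ℂ} (hσ : σ.PosSemidef)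
    (u : UnitVector d) : 0 ≤ (ketbra u * σ).trace := by
  have h := hσ.dotProduct_mulVec_nonneg (fun a => u.1 a)
  convert h using 1
  simp only [ketbra, Matrix.trace, Matrix.diag_apply, Matrix.mul_apply, dotProduct, Matrix.mulVec,
    Pi.star_apply, Finset.mul_sum]
  rw [Finset.sum_comm]
  refine Finset.sum_congr rfl fun x _ => Finset.sum_congr rfl fun y _ => ?_
  ring

theorem continuous_povmDensity (σ : Matrix (Fin d) (Fin d) ℂ) :
    Continuous fun u : UnitVector d => (d : ℝ) * ((ketbra u * σ).trace).re := by
  have := continuous_ketbra (d := d)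
  fun_prop

theorem integral_uniformPOVM {σ : Matrix (Fin d) (Fin d) ℂ} (hσ : σ.PosSemidef)
    (f : UnitVector d → ℂ) :
    ∫ u, f u ∂(uniformPOVM σ) =
      d * ∫ u, f u * (ketbra u * σ).trace ∂(haarUnitVector d) := by
  rw [uniformPOVM, integral_withDensity_eq_integral_toReal_smul
    (continuous_povmDensity σ).measurable.ennreal_ofReal
    (Filter.Eventually.of_forall fun u => ENNReal.ofReal_lt_top), ← integral_const_mul]
  refine integral_congr_ae (Filter.Eventually.of_forall fun u => ?_)
  have h := trace_ketbra_mul_nonneg hσ u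
  have h' : (((ketbra u * σ).trace.re : ℝ) : ℂ) = (ketbra u * σ).trace :=
    (Complex.eq_re_of_ofReal_le h).symm
  have h0 : 0 ≤ (ketbra u * σ).trace.re := (Complex.le_def.mp h).1
  dsimp only
  rw [ENNReal.toReal_ofReal (by positivity), Complex.real_smul, Complex.ofReal_mul, h',
    Complex.ofReal_natCast]
  ring

theorem trace_stateEstimator_mul (u : UnitVector d) (M : Matrix (Fin d) (Fin d) ℂ) :
    (stateEstimator u * M).trace = ((d : ℂ) + 1) * (ketbra u * M).trace - M.trace := by
  rw [stateEstimator, sub_mul, Matrix.smul_mul, one_mul, Matrix.trace_sub, Matrix.trace_smul,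
    smul_eq_mul]

theorem continuous_stateEstimator :
    Continuous (stateEstimator : UnitVector d → Matrix (Fin d) (Fin d) ℂ) := by
  have hk := continuous_ketbra (d := d)
  unfold stateEstimator
  fun_prop

theorem conjTranspose_stateEstimator (u : UnitVector d) :
    (stateEstimator u)ᴴ = stateEstimator u := by
  simp [stateEstimator, conjTranspose_ketbra]

variable [NeZero d]

theorem IsDensityMatrix.isProbabilityMeasure_uniformPOVM {σ : Matrix (Fin d) (Fin d) ℂ}
    (hσ : IsDensityMatrix σ) : IsProbabilityMeasure (uniformPOVM σ) := by
  have hfin : IsFiniteMeasure (uniformPOVM σ) := by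
    refine isFiniteMeasure_withDensity_ofReal ?_
    exact (continuous_integrable (continuous_povmDensity σ)).2
  have h1 := integral_uniformPOVM hσ.1 fun _ => 1
  have h2 := haarMoment_one_one σ
  simp only [haarMoment, mul_one, trace_ketbra, one_mul] at h2
  simp only [one_mul, h2, hσ.2, integral_const, Complex.real_smul, mul_one] at h1
  refine ⟨?_⟩
  have h3 : (uniformPOVM σ).real Set.univ = 1 := by exact_mod_cast h1
  rw [measureReal_def] at h3
  rw [← ENNReal.ofReal_toReal (measure_ne_top (uniformPOVM σ) Set.univ), h3, ENNReal.ofReal_one]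

theorem integral_trace_ketbra_mul {σ : Matrix (Fin d) (Fin d) ℂ} (hσ : IsDensityMatrix σ)
    (B : Matrix (Fin d) (Fin d) ℂ) :
    ((d : ℂ) + 1) * ∫ u, (ketbra u * B).trace ∂(uniformPOVM σ) = B.trace + (B * σ).trace := by
  rw [integral_uniformPOVM hσ.1]
  have h := haarMoment_one B σ
  simp only [haarMoment, mul_one, trace_ketbra, one_mul] at h
  rw [hσ.2] at h
  linear_combination h

theorem integral_trace_ketbra_mul_trace_ketbra_mul {σ : Matrix (Fin d) (Fin d) ℂ}
    (hσ : IsDensityMatrix σ) (B C : Matrix (Fin d) (Fin d) ℂ) :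
    ((d : ℂ) + 1) * ((d : ℂ) + 2) *
      ∫ u, (ketbra u * B).trace * (ketbra u * C).trace ∂(uniformPOVM σ) =
      B.trace * (C.trace + (C * σ).trace) + (B * C).trace
        + (B * C * σ).trace + C.trace * (B * σ).trace + (C * B * σ).trace := by
  rw [integral_uniformPOVM hσ.1]
  have h := haarMoment_eq_trace B C σ
  simp only [haarMoment] at h
  rw [hσ.2] at h
  linear_combination h

/-- The mean of a polynomial of degree two in the outcome of the uniform POVM. -/
theorem integral_quadratic {σ : Matrix (Fin d) (Fin d) ℂ}
    (hσ : IsDensityMatrix σ) (B C L : Matrix (Fin d) (Fin d) ℂ) (c : ℂ) :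
    ((d : ℂ) + 2) * ∫ u, (((d : ℂ) + 1) ^ 2 * ((ketbra u * B).trace * (ketbra u * C).trace)
        - ((d : ℂ) + 1) * (ketbra u * L).trace + c) ∂(uniformPOVM σ) =
      ((d : ℂ) + 1) * (B.trace * (C.trace + (C * σ).trace) + (B * C).trace
        + (B * C * σ).trace + C.trace * (B * σ).trace + (C * B * σ).trace)
      - ((d : ℂ) + 2) * (L.trace + (L * σ).trace) + ((d : ℂ) + 2) * c := by
  have := hσ.isProbabilityMeasure_uniformPOVM
  have hk := continuous_ketbra (d := d)
  have i1 : Integrable (fun u : UnitVector d =>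
      ((d : ℂ) + 1) ^ 2 * ((ketbra u * B).trace * (ketbra u * C).trace)) (uniformPOVM σ) :=
    continuous_integrable (by fun_prop)
  have i2 : Integrable (fun u : UnitVector d => ((d : ℂ) + 1) * (ketbra u * L).trace)
      (uniformPOVM σ) := continuous_integrable (by fun_prop)
  have i3 : Integrable (fun u : UnitVector d =>
      ((d : ℂ) + 1) ^ 2 * ((ketbra u * B).trace * (ketbra u * C).trace)
        - ((d : ℂ) + 1) * (ketbra u * L).trace) (uniformPOVM σ) := i1.sub i2
  rw [integral_add i3 (integrable_const c), integral_sub i1 i2, integral_const_mul,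
    integral_const_mul, integral_const]
  have h1 := integral_trace_ketbra_mul hσ L
  have h2 := integral_trace_ketbra_mul_trace_ketbra_mul hσ B C
  simp only [probReal_univ, one_smul]
  linear_combination ((d : ℂ) + 1) * h2 - ((d : ℂ) + 2) * h1

/-- The single-copy estimator is unbiased. -/
theorem integral_trace_stateEstimator_mul {σ : Matrix (Fin d) (Fin d) ℂ}
    (hσ : IsDensityMatrix σ) (M : Matrix (Fin d) (Fin d) ℂ) :
    ∫ u, (stateEstimator u * M).trace ∂(uniformPOVM σ) = (σ * M).trace := by
  have := hσ.isProbabilityMeasure_uniformPOVM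
  have hk := continuous_ketbra (d := d)
  simp only [trace_stateEstimator_mul]
  rw [integral_sub (continuous_integrable (by fun_prop)) (integrable_const _), integral_const_mul,
    integral_trace_ketbra_mul hσ, integral_const, probReal_univ, one_smul, Matrix.trace_mul_comm σ]
  ring

/-- In the exact second moment the terms containing `tr M` combine into minus `|tr M + tr (M σ)|²`
plus `|tr (M σ)|²`. The first has a favourable sign and is dropped, so no dependence on `tr M`
survives, which is why the bound carries no dimension factor. -/
theorem integral_norm_trace_sq_le {σ : Matrix (Fin d) (Fin d) ℂ}
    (hσ : IsDensityMatrix σ) (M : Matrix (Fin d) (Fin d) ℂ) :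
    ∫ u, ‖(stateEstimator u * M).trace‖ ^ 2 ∂(uniformPOVM σ) ≤ 3 * ‖M‖ ^ 2 := by
  have hpt : ∀ u : UnitVector d, ((‖(stateEstimator u * M).trace‖ ^ 2 : ℝ) : ℂ) =
      ((d : ℂ) + 1) ^ 2 * ((ketbra u * M).trace * (ketbra u * Mᴴ).trace)
        - ((d : ℂ) + 1) * (ketbra u * (Mᴴ.trace • M + M.trace • Mᴴ)).trace
        + M.trace * Mᴴ.trace := fun u => by
    have hs : star ((stateEstimator u * M).trace) = (stateEstimator u * Mᴴ).trace := by
      rw [← Matrix.trace_conjTranspose, Matrix.conjTranspose_mul, conjTranspose_stateEstimator,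
        Matrix.trace_mul_comm]
    rw [Complex.ofReal_pow, ← Complex.mul_conj', starRingEnd_apply, hs,
      trace_stateEstimator_mul, trace_stateEstimator_mul]
    simp only [mul_add, Matrix.mul_smul, Matrix.trace_add, Matrix.trace_smul, smul_eq_mul]
    ring
  have h := integral_quadratic hσ M Mᴴ (Mᴴ.trace • M + M.trace • Mᴴ) (M.trace * Mᴴ.trace)
  simp only [← hpt] at h
  rw [integral_complex_ofReal] at h
  set E := ∫ u, ‖(stateEstimator u * M).trace‖ ^ 2 ∂(uniformPOVM σ)
  have hσ1 := hσ.norm_le_one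
  have hx : ((M * Mᴴ * σ).trace).re ≤ ‖M‖ ^ 2 := by
    refine (Complex.re_le_norm _).trans ((norm_trace_mul_le _ _).trans ?_)
    have h1 : ‖M * Mᴴ‖ ≤ ‖M‖ * ‖Mᴴ‖ := norm_mul_le _ _
    rw [Matrix.frobenius_norm_conjTranspose] at h1
    nlinarith [norm_nonneg (M * Mᴴ), norm_nonneg σ]
  have hy : ((Mᴴ * M * σ).trace).re ≤ ‖M‖ ^ 2 := by
    refine (Complex.re_le_norm _).trans ((norm_trace_mul_le _ _).trans ?_)
    have h1 : ‖Mᴴ * M‖ ≤ ‖Mᴴ‖ * ‖M‖ := norm_mul_le _ _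
    rw [Matrix.frobenius_norm_conjTranspose] at h1
    nlinarith [norm_nonneg (Mᴴ * M), norm_nonneg σ]
  have hq : ‖(M * σ).trace‖ ^ 2 ≤ ‖M‖ ^ 2 := by
    refine pow_le_pow_left₀ (norm_nonneg _) ((norm_trace_mul_le _ _).trans ?_) 2
    nlinarith [norm_nonneg M, norm_nonneg σ]
  have hqs : (Mᴴ * σ).trace = star ((M * σ).trace) := by
    rw [← Matrix.trace_conjTranspose, Matrix.conjTranspose_mul, hσ.1.1.eq, Matrix.trace_mul_comm]
  have hts : Mᴴ.trace = star M.trace := Matrix.trace_conjTranspose M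
  have hsq : ∀ z : ℂ, z * star z = ((‖z‖ ^ 2 : ℝ) : ℂ) := fun z => by
    rw [Complex.ofReal_pow, ← Complex.mul_conj', starRingEnd_apply]
  have hE : ((d : ℂ) + 2) * E = ((d : ℂ) + 1) * (((‖M‖ ^ 2 : ℝ) : ℂ) + (M * Mᴴ * σ).trace
      + (Mᴴ * M * σ).trace) - (((‖M.trace + (M * σ).trace‖ ^ 2 : ℝ) : ℂ)
        - ((‖(M * σ).trace‖ ^ 2 : ℝ) : ℂ)) := by
    rw [h, ← hsq, ← hsq, ← trace_mul_conjTranspose_self, hts, hqs]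
    simp only [star_add, add_mul, Matrix.smul_mul, Matrix.trace_add, Matrix.trace_smul,
      smul_eq_mul, hqs, hts]
    ring
  have hre := congrArg Complex.re hE
  have hd : (0 : ℝ) ≤ d := Nat.cast_nonneg d
  rw [show ((d : ℂ) + 2) = ((d + 2 : ℝ) : ℂ) by push_cast; rfl,
    show ((d : ℂ) + 1) = ((d + 1 : ℝ) : ℂ) by push_cast; rfl, ← Complex.ofReal_mul] at hre
  simp only [Complex.sub_re, Complex.re_ofReal_mul, Complex.add_re, Complex.ofReal_re] at hre
  have h0 : 0 ≤ ‖M.trace + (M * σ).trace‖ ^ 2 := by positivity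
  -- Three terms of weight `d + 1` and one of weight `1`: `3 (d + 1) + 1 ≤ 3 (d + 2)`.
  have h1 : ((d : ℝ) + 2) * E ≤ (d + 2) * (3 * ‖M‖ ^ 2) := by
    nlinarith [sq_nonneg ‖M‖]
  exact le_of_mul_le_mul_left h1 (by positivity)

/-- With `B = Pᴴ P` and `D = A Aᴴ`, the squared norm is a quadratic polynomial in `|u⟩⟨u|` because a
rank-one projector compresses `D` to a scalar. The exact mean has a main part of products of traces
in `B` and `D`, each at most `‖P‖² ‖A‖²`, and a remainder that completes to a difference of squares.
-/
theorem integral_norm_mul_stateEstimator_mul_sq_le {σ : Matrix (Fin d) (Fin d) ℂ}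
    (hσ : IsDensityMatrix σ) (P A : Matrix (Fin d) (Fin d) ℂ) :
    ∫ u, ‖P * stateEstimator u * A‖ ^ 2 ∂(uniformPOVM σ) ≤ 3 * ‖P‖ ^ 2 * ‖A‖ ^ 2 := by
  obtain ⟨B, hB⟩ : ∃ B, B = Pᴴ * P := ⟨_, rfl⟩
  obtain ⟨D, hD⟩ : ∃ D, D = A * Aᴴ := ⟨_, rfl⟩
  have hnorm : ∀ X : Matrix (Fin d) (Fin d) ℂ, Xᴴ = X →
      ((‖P * X * A‖ ^ 2 : ℝ) : ℂ) = (X * D * X * B).trace := fun X hX => by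
    rw [← trace_mul_conjTranspose_self, Matrix.conjTranspose_mul, Matrix.conjTranspose_mul, hX,
      hB, hD, mul_assoc, mul_assoc, Matrix.trace_mul_comm]
    simp only [mul_assoc]
  have hpt : ∀ u : UnitVector d, ((‖P * stateEstimator u * A‖ ^ 2 : ℝ) : ℂ) =
      ((d : ℂ) + 1) ^ 2 * ((ketbra u * B).trace * (ketbra u * D).trace)
        - ((d : ℂ) + 1) * (ketbra u * (B * D + D * B)).trace
        + (B * D).trace := fun u => by
    rw [hnorm _ (conjTranspose_stateEstimator u)]
    have e1 : stateEstimator u * D * stateEstimator u * B =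
        ((d : ℂ) + 1) ^ 2 • (ketbra u * D * ketbra u * B) - ((d : ℂ) + 1) • (ketbra u * D * B)
        - ((d : ℂ) + 1) • (D * ketbra u * B) + D * B := by
      simp only [stateEstimator, sub_mul, mul_sub, Matrix.smul_mul, Matrix.mul_smul, one_mul,
        mul_one, smul_smul, sq]
      abel
    rw [e1, ketbra_mul_mul_ketbra, mul_assoc D, Matrix.trace_add, Matrix.trace_sub,
      Matrix.trace_sub]
    simp only [Matrix.trace_smul, Matrix.smul_mul, smul_eq_mul, mul_add, Matrix.trace_add]
    rw [Matrix.trace_mul_comm D (ketbra u * B), Matrix.trace_mul_comm D B]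
    simp only [mul_assoc]
    ring
  have h := integral_quadratic hσ B D (B * D + D * B) (B * D).trace
  simp only [← hpt] at h
  rw [integral_complex_ofReal] at h
  set E := ∫ u, ‖P * stateEstimator u * A‖ ^ 2 ∂(uniformPOVM σ)
  have hσ1 := hσ.norm_le_one
  have htB : B.trace = ((‖P‖ ^ 2 : ℝ) : ℂ) := by
    rw [hB, Matrix.trace_mul_comm, trace_mul_conjTranspose_self]
  have htD : D.trace = ((‖A‖ ^ 2 : ℝ) : ℂ) := by
    rw [hD, trace_mul_conjTranspose_self]
  have hBσ : ((B * σ).trace).re ≤ ‖P‖ ^ 2 := by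
    refine (Complex.re_le_norm _).trans ((norm_trace_mul_le _ _).trans ?_)
    have h1 : ‖B‖ ≤ ‖Pᴴ‖ * ‖P‖ := hB ▸ norm_mul_le _ _
    rw [Matrix.frobenius_norm_conjTranspose] at h1
    nlinarith [norm_nonneg B, norm_nonneg σ]
  have hDσ : ((D * σ).trace).re ≤ ‖A‖ ^ 2 := by
    refine (Complex.re_le_norm _).trans ((norm_trace_mul_le _ _).trans ?_)
    have h1 : ‖D‖ ≤ ‖A‖ * ‖Aᴴ‖ := hD ▸ norm_mul_le _ _
    rw [Matrix.frobenius_norm_conjTranspose] at h1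
    nlinarith [norm_nonneg D, norm_nonneg σ]
  have hPσA : ‖P * σ * A‖ ^ 2 ≤ ‖P‖ ^ 2 * ‖A‖ ^ 2 := by
    rw [← mul_pow]
    refine pow_le_pow_left₀ (norm_nonneg _) ?_ 2
    have h1 : ‖P * σ * A‖ ≤ ‖P * σ‖ * ‖A‖ := norm_mul_le _ _
    have h2 : ‖P * σ‖ ≤ ‖P‖ * ‖σ‖ := norm_mul_le _ _
    have h3 : ‖P‖ * ‖σ‖ ≤ ‖P‖ := mul_le_of_le_one_right (norm_nonneg _) hσ1
    exact h1.trans (mul_le_mul_of_nonneg_right (h2.trans h3) (norm_nonneg _))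
  -- Completing the square in `1 + σ`: this sum enters the mean with coefficient `(d + 1) - (d + 2)
  -- = -1`, so only the subtracted `‖P σ A‖²` costs anything.
  have hsum : (B * D).trace + (B * D * σ).trace + (D * B * σ).trace =
      ((‖P * (1 + σ) * A‖ ^ 2 : ℝ) : ℂ) - ((‖P * σ * A‖ ^ 2 : ℝ) : ℂ) := by
    rw [hnorm _ (by simp [hσ.1.1.eq]), hnorm _ hσ.1.1.eq]
    have e1 : (1 + σ) * D * (1 + σ) * B = D * B + D * σ * B + σ * D * B + σ * D * σ * B := by
      noncomm_ring
    rw [e1]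
    simp only [Matrix.trace_add]
    rw [Matrix.trace_mul_comm B D, mul_assoc σ D B, Matrix.trace_mul_comm σ, mul_assoc B D σ,
      Matrix.trace_mul_comm B]
    ring
  have hE : ((d : ℂ) + 2) * E = ((d : ℂ) + 1) * (((‖P‖ ^ 2 : ℝ) : ℂ) * ((‖A‖ ^ 2 : ℝ) : ℂ)
      + ((‖P‖ ^ 2 : ℝ) : ℂ) * (D * σ).trace + ((‖A‖ ^ 2 : ℝ) : ℂ) * (B * σ).trace)
      - (((‖P * (1 + σ) * A‖ ^ 2 : ℝ) : ℂ) - ((‖P * σ * A‖ ^ 2 : ℝ) : ℂ)) := by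
    rw [h, ← hsum, htB, htD]
    simp only [add_mul, Matrix.trace_add]
    rw [Matrix.trace_mul_comm D B]
    ring
  have hre := congrArg Complex.re hE
  have hd : (0 : ℝ) ≤ d := Nat.cast_nonneg d
  rw [show ((d : ℂ) + 2) = ((d + 2 : ℝ) : ℂ) by push_cast; rfl,
    show ((d : ℂ) + 1) = ((d + 1 : ℝ) : ℂ) by push_cast; rfl, ← Complex.ofReal_mul,
    ← Complex.ofReal_mul] at hre
  simp only [Complex.sub_re, Complex.re_ofReal_mul, Complex.add_re, Complex.ofReal_re] at hre
  have h0 : 0 ≤ ‖P * (1 + σ) * A‖ ^ 2 := by positivity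
  have hx := mul_le_mul_of_nonneg_left hDσ (sq_nonneg ‖P‖)
  have hy := mul_le_mul_of_nonneg_left hBσ (sq_nonneg ‖A‖)
  have h1 : ((d : ℝ) + 2) * E ≤ (d + 2) * (3 * ‖P‖ ^ 2 * ‖A‖ ^ 2) := by
    have hpa : 0 ≤ ‖P‖ ^ 2 * ‖A‖ ^ 2 := by positivity
    have hz := mul_le_mul_of_nonneg_left (add_le_add hx hy) (by positivity : (0 : ℝ) ≤ d + 1)
    nlinarith
  exact le_of_mul_le_mul_left h1 (by positivity)

end POVM

/-! ### Integrating out one coordinate of a product measure by resampling it. -/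

section Resampling

variable {ι S : Type*} [Fintype ι] [DecidableEq ι] [MeasurableSpace S]

/-- Resampling one coordinate preserves a product of probability measures. -/
theorem measurePreserving_update (ν : Measure S) [IsProbabilityMeasure ν] (i : ι) :
    MeasurePreserving (fun p : (ι → S) × S => Function.update p.1 i p.2)
      ((Measure.pi fun _ => ν).prod ν) (Measure.pi fun _ => ν) := by
  have hm : Measurable (fun p : (ι → S) × S => Function.update p.1 i p.2) := by
    refine measurable_pi_lambda _ fun j => ?_
    by_cases h : j = i
    · subst h; simpa using measurable_snd
    · simp only [Function.update_of_ne h]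
      exact (measurable_pi_apply j).comp measurable_fst
  refine ⟨hm, (Measure.pi_eq fun s hs => ?_).symm⟩
  have hpre : (fun p : (ι → S) × S => Function.update p.1 i p.2) ⁻¹' Set.univ.pi s =
      (Set.univ.pi (Function.update s i Set.univ)) ×ˢ s i := by
    ext p
    simp only [Set.mem_preimage, Set.mem_univ_pi, Set.mem_prod]
    constructor
    · refine fun h => ⟨fun j => ?_, by simpa using h i⟩
      by_cases hj : j = i
      · subst hj; simp
      · simpa [hj] using h j
    · rintro ⟨h, h'⟩ j
      by_cases hj : j = i
      · subst hj; simpa using h'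
      · simpa [hj] using h j
  rw [Measure.map_apply hm (MeasurableSet.univ_pi hs), hpre, Measure.prod_prod, Measure.pi_pi,
    ← Finset.mul_prod_erase _ _ (Finset.mem_univ i),
    ← Finset.mul_prod_erase _ (fun j => ν (s j)) (Finset.mem_univ i)]
  rw [Function.update_self, measure_univ, one_mul, mul_comm]
  congr 1
  refine Finset.prod_congr rfl fun j hj => ?_
  rw [Function.update_of_ne (Finset.ne_of_mem_erase hj)]

theorem integral_pi_eq_integral_update {E : Type*} [NormedAddCommGroup E] [NormedSpace ℝ E]
    (ν : Measure S) [IsProbabilityMeasure ν] (i : ι) {f : (ι → S) → E}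
    (hf : Integrable f (Measure.pi fun _ => ν)) :
    ∫ u, f u ∂(Measure.pi fun _ => ν) =
      ∫ u, ∫ v, f (Function.update u i v) ∂ν ∂(Measure.pi fun _ => ν) := by
  have h := measurePreserving_update ν i
  have hf' : AEStronglyMeasurable f
      (((Measure.pi fun _ => ν).prod ν).map fun p : (ι → S) × S => Function.update p.1 i p.2) := by
    rw [h.map_eq]; exact hf.aestronglyMeasurable
  rw [integral_integral (f := fun u v => f (Function.update u i v))]
  · conv_lhs => rw [← h.map_eq]
    exact integral_map h.measurable.aemeasurable hf'
  · exact h.integrable_comp_of_integrable hf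

end Resampling

/-! ### Words mixing random estimators with their mean, and their second moments. -/

section Hybrid

variable {d n : ℕ} (σ : Matrix (Fin d) (Fin d) ℂ)

/-- The single-copy estimators at the positions in `S`, and their common mean `σ` elsewhere. -/
noncomputable def hybridEstimator (S : Finset (Fin n)) (u : Fin n → UnitVector d) (i : Fin n) :
    Matrix (Fin d) (Fin d) ℂ :=
  if i ∈ S then stateEstimator (u i) else σ

/-- The ordered product of the hybrid estimators along a list of positions. -/
noncomputable def hybridProd (S : Finset (Fin n)) (l : List (Fin n)) (u : Fin n → UnitVector d) :
    Matrix (Fin d) (Fin d) ℂ :=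
  (l.map (hybridEstimator σ S u)).prod

theorem hybridProd_nil (S : Finset (Fin n)) (u : Fin n → UnitVector d) :
    hybridProd σ S [] u = 1 := rfl

theorem hybridProd_cons (S : Finset (Fin n)) (i : Fin n) (l : List (Fin n))
    (u : Fin n → UnitVector d) :
    hybridProd σ S (i :: l) u = hybridEstimator σ S u i * hybridProd σ S l u := by
  simp [hybridProd]

theorem hybridProd_append (S : Finset (Fin n)) (l l' : List (Fin n)) (u : Fin n → UnitVector d) :
    hybridProd σ S (l ++ l') u = hybridProd σ S l u * hybridProd σ S l' u := by
  simp [hybridProd]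

theorem continuous_hybridProd (S : Finset (Fin n)) (l : List (Fin n)) :
    Continuous (hybridProd (d := d) σ S l) := by
  induction l with
  | nil => exact continuous_const
  | cons i l ih =>
    have h : Continuous fun u : Fin n → UnitVector d => hybridEstimator σ S u i := by
      unfold hybridEstimator
      split_ifs
      · exact continuous_stateEstimator.comp (continuous_apply i)
      · exact continuous_const
    have : hybridProd (d := d) σ S (i :: l) =
        fun u => hybridEstimator σ S u i * hybridProd σ S l u := by
      funext u; exact hybridProd_cons σ S i l u
    rw [this]
    exact h.matrix_mul ih

theorem hybridProd_congr {S T : Finset (Fin n)} {l : List (Fin n)} {u w : Fin n → UnitVector d}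
    (h : ∀ i ∈ l, (i ∈ S ↔ i ∈ T) ∧ (i ∈ S → u i = w i)) :
    hybridProd σ S l u = hybridProd σ T l w := by
  unfold hybridProd
  congr 1
  refine List.map_congr_left fun i hi => ?_
  obtain ⟨h1, h2⟩ := h i hi
  unfold hybridEstimator
  by_cases hS : i ∈ S
  · rw [if_pos hS, if_pos (h1.mp hS), h2 hS]
  · rw [if_neg hS, if_neg fun hT => hS (h1.mpr hT)]

theorem hybridProd_update_of_notMem {S : Finset (Fin n)} {l : List (Fin n)} {i : Fin n}
    (hi : i ∉ l) (u : Fin n → UnitVector d) (v : UnitVector d) :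
    hybridProd σ S l (Function.update u i v) = hybridProd σ S l u :=
  hybridProd_congr σ fun j hj => ⟨Iff.rfl, fun _ =>
    Function.update_of_ne (fun h : j = i => hi (h ▸ hj)) _ _⟩

theorem hybridProd_of_disjoint {S : Finset (Fin n)} {l : List (Fin n)} (h : ∀ i ∈ l, i ∉ S)
    (u : Fin n → UnitVector d) : hybridProd σ S l u = σ ^ l.length := by
  unfold hybridProd
  rw [List.prod_eq_pow_card _ σ, List.length_map]
  intro M hM
  obtain ⟨i, hi, rfl⟩ := List.mem_map.mp hM
  exact if_neg (h i hi)

variable {σ}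

/-- Averaging over one outcome replaces its estimator by the mean. -/
theorem integral_trace_hybridProd_update (hσ : IsDensityMatrix σ) {S : Finset (Fin n)}
    {l : List (Fin n)} (hl : l.Nodup) (i : Fin n) (u : Fin n → UnitVector d) :
    ∫ v, (hybridProd σ S l (Function.update u i v)).trace ∂(uniformPOVM σ) =
      (hybridProd σ (S.erase i) l u).trace := by
  have := hσ.neZero
  have := hσ.isProbabilityMeasure_uniformPOVM
  by_cases hi : i ∈ l ∧ i ∈ S
  · obtain ⟨hil, hiS⟩ := hi
    obtain ⟨s, t, rfl⟩ := List.append_of_mem hil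
    have hs : i ∉ s := fun h => (List.nodup_append.mp hl).2.2 i h i (by simp) rfl
    have ht : i ∉ t := (List.nodup_cons.mp (List.nodup_append.mp hl).2.1).1
    have he : ∀ l' : List (Fin n), i ∉ l' →
        hybridProd σ (S.erase i) l' u = hybridProd σ S l' u := fun l' hl' =>
      hybridProd_congr σ fun j hj => by
        have : j ≠ i := fun h => hl' (h ▸ hj)
        simp [this]
    simp only [hybridProd_append, hybridProd_cons, hybridProd_update_of_notMem σ hs,
      hybridProd_update_of_notMem σ ht, he s hs, he t ht]
    have e1 : ∀ v, hybridEstimator σ S (Function.update u i v) i = stateEstimator v := fun v => by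
      simp [hybridEstimator, hiS]
    have e2 : hybridEstimator σ (S.erase i) u i = σ := by simp [hybridEstimator]
    simp only [e1, e2]
    -- Since the list has no repetition, position `i` occurs exactly once; cyclicity brings its
    -- estimator to the front, where unbiasedness applies.
    have e3 : ∀ A X B : Matrix (Fin d) (Fin d) ℂ, (A * (X * B)).trace = (X * (B * A)).trace :=
      fun A X B => by rw [Matrix.trace_mul_comm, mul_assoc]
    simp only [e3 (hybridProd σ S s u)]
    exact integral_trace_stateEstimator_mul hσ _
  · have h1 : ∀ v, hybridProd σ S l (Function.update u i v) = hybridProd σ (S.erase i) l u :=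
      fun v => hybridProd_congr σ fun j hj => by
        by_cases hji : j = i
        · subst hji
          have : j ∉ S := fun h => hi ⟨hj, h⟩
          simp [this]
        · simp [hji]
    simp [h1]

/-- Positions on which the other factor does not depend can be averaged out. -/
theorem integral_trace_hybridProd_mul (hσ : IsDensityMatrix σ) (S : Finset (Fin n))
    {l : List (Fin n)} (hl : l.Nodup) {g : (Fin n → UnitVector d) → ℂ} (hg : Continuous g)
    (R : Finset (Fin n)) (hR : ∀ i ∈ R, ∀ u v, g (Function.update u i v) = g u) :
    ∫ u, (hybridProd σ S l u).trace * g u ∂(outcomeLaw n σ) =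
      ∫ u, (hybridProd σ (S \ R) l u).trace * g u ∂(outcomeLaw n σ) := by
  have := hσ.neZero
  have := hσ.isProbabilityMeasure_uniformPOVM
  unfold outcomeLaw
  induction R using Finset.induction_on with
  | empty => simp
  | insert i R _ ih =>
    rw [ih fun j hj => hR j (Finset.mem_insert_of_mem hj), Finset.sdiff_insert,
      integral_pi_eq_integral_update (f := fun u => (hybridProd σ (S \ R) l u).trace * g u) _ i
        (continuous_integrable ((continuous_hybridProd σ _ l).matrix_trace.mul hg))]
    refine integral_congr_ae (Filter.Eventually.of_forall fun u => ?_)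
    simp only [hR i (Finset.mem_insert_self i R)]
    rw [integral_mul_const, integral_trace_hybridProd_update hσ hl]

theorem integral_trace_hybridProd (hσ : IsDensityMatrix σ) (S : Finset (Fin n))
    {l : List (Fin n)} (hl : l.Nodup) :
    ∫ u, (hybridProd σ S l u).trace ∂(outcomeLaw n σ) = (σ ^ l.length).trace := by
  have := hσ.neZero
  have := hσ.isProbabilityMeasure_uniformPOVM
  have hp : IsProbabilityMeasure (outcomeLaw n σ) := by unfold outcomeLaw; infer_instance
  have h := integral_trace_hybridProd_mul hσ S hl (g := fun _ => 1) continuous_const S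
    fun _ _ _ _ => rfl
  simp only [mul_one, sdiff_self, Finset.bot_eq_empty] at h
  rw [h]
  simp [hybridProd_of_disjoint]

/-- Each factor ignores the outcomes outside its own list, so the estimators of the other factor at
those outcomes may be replaced by `σ`. This is done in one factor and then in the other, leaving
only the shared positions random. -/
theorem integral_trace_mul_trace (hσ : IsDensityMatrix σ)
    {l l' : List (Fin n)} (hl : l.Nodup) (hl' : l'.Nodup) :
    ∫ u, (hybridProd σ Finset.univ l u).trace * (hybridProd σ Finset.univ l' u).trace
        ∂(outcomeLaw n σ) =
      ∫ u, (hybridProd σ l'.toFinset l u).trace * (hybridProd σ l.toFinset l' u).trace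
        ∂(outcomeLaw n σ) := by
  have h1 := integral_trace_hybridProd_mul hσ Finset.univ hl
    (g := fun u => (hybridProd σ Finset.univ l' u).trace)
    (continuous_hybridProd σ _ l').matrix_trace (Finset.univ \ l'.toFinset) (fun i hi u v => by
      rw [hybridProd_update_of_notMem σ (by simpa using hi)])
  have h2 := integral_trace_hybridProd_mul hσ Finset.univ hl'
    (g := fun u => (hybridProd σ l'.toFinset l u).trace)
    (continuous_hybridProd σ _ l).matrix_trace (Finset.univ \ l.toFinset) (fun i hi u v => by
      rw [hybridProd_update_of_notMem σ (by simpa using hi)])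
  rw [Finset.sdiff_sdiff_eq_self (Finset.subset_univ _)] at h1 h2
  rw [h1]
  simp only [mul_comm _ (hybridProd σ _ l' _).trace]
  rw [h2]

/-- Induction along the word, with `σ ^ a` collecting the deterministic letters already passed. A
deterministic letter raises `a`; a random one costs `3`, splits off `‖σ ^ a‖²` and restarts with `a
= 0`, and Chebyshev's inequality reunites the two powers at cost `d`. -/
theorem integral_norm_mul_hybridProd_mul_sq_le (hσ : IsDensityMatrix σ) (S : Finset (Fin n))
    {l : List (Fin n)} (hl : l.Nodup) (a b : ℕ) :
    ∫ u, ‖σ ^ a * hybridProd σ S l u * σ ^ b‖ ^ 2 ∂(outcomeLaw n σ) ≤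
      (3 * d) ^ l.countP (· ∈ S) * ‖σ ^ (a + b + l.countP (· ∉ S))‖ ^ 2 := by
  have := hσ.neZero
  have := hσ.isProbabilityMeasure_uniformPOVM
  have hp : IsProbabilityMeasure (outcomeLaw n σ) := by unfold outcomeLaw; infer_instance
  induction l generalizing a with
  | nil => simp [hybridProd_nil, ← pow_add]
  | cons i l ih =>
    have hil : i ∉ l := (List.nodup_cons.mp hl).1
    have ih := ih (List.nodup_cons.mp hl).2
    by_cases hi : i ∈ S
    · rw [List.countP_cons_of_pos (by simpa using hi),
        List.countP_cons_of_neg (by simpa using hi)]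
      have hc := continuous_hybridProd (d := d) σ S l
      have hc' := continuous_hybridProd (d := d) σ S (i :: l)
      have hstep : ∫ u, ‖σ ^ a * hybridProd σ S (i :: l) u * σ ^ b‖ ^ 2 ∂(outcomeLaw n σ) ≤
          ∫ u, 3 * ‖σ ^ a‖ ^ 2 * ‖σ ^ 0 * hybridProd σ S l u * σ ^ b‖ ^ 2 ∂(outcomeLaw n σ) := by
        unfold outcomeLaw
        rw [integral_pi_eq_integral_update _ i (continuous_integrable (by fun_prop))]
        refine integral_mono_of_nonneg (Filter.Eventually.of_forall fun u =>
          integral_nonneg fun v => by positivity) (continuous_integrable (by fun_prop))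
          (Filter.Eventually.of_forall fun u => ?_)
        simp only [hybridProd_cons, hybridProd_update_of_notMem σ hil, pow_zero, one_mul]
        have e1 : ∀ v, hybridEstimator σ S (Function.update u i v) i = stateEstimator v :=
          fun v => by simp [hybridEstimator, hi]
        simp only [e1, ← mul_assoc]
        simp only [mul_assoc (σ ^ a * _)]
        exact integral_norm_mul_stateEstimator_mul_sq_le hσ _ _
      refine hstep.trans ?_
      rw [integral_const_mul]
      have h0 := ih 0
      have hch := norm_sq_pow_mul_le hσ.1 a (0 + b + l.countP (· ∉ S))
      calc 3 * ‖σ ^ a‖ ^ 2 * ∫ u, ‖σ ^ 0 * hybridProd σ S l u * σ ^ b‖ ^ 2 ∂(outcomeLaw n σ)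
          ≤ 3 * ‖σ ^ a‖ ^ 2 * ((3 * d) ^ l.countP (· ∈ S) *
              ‖σ ^ (0 + b + l.countP (· ∉ S))‖ ^ 2) := by gcongr
        _ = 3 * (3 * d) ^ l.countP (· ∈ S) *
              (‖σ ^ a‖ ^ 2 * ‖σ ^ (0 + b + l.countP (· ∉ S))‖ ^ 2) := by ring
        _ ≤ 3 * (3 * d) ^ l.countP (· ∈ S) *
              (d * ‖σ ^ (a + (0 + b + l.countP (· ∉ S)))‖ ^ 2) := by gcongr
        _ = _ := by rw [zero_add, add_assoc]; ring
    · rw [List.countP_cons_of_neg (by simpa using hi),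
        List.countP_cons_of_pos (by simpa using hi)]
      have e1 : ∀ u : Fin n → UnitVector d, hybridEstimator σ S u i = σ :=
        fun u => by simp [hybridEstimator, hi]
      simp only [hybridProd_cons, e1, ← mul_assoc, ← pow_succ]
      refine (ih (a + 1)).trans (le_of_eq ?_)
      congr 4
      ring

/-- The first random letter is averaged against the trace at cost `3` alone, since cyclicity puts
everything else into a single matrix; only the remaining random letters cost `3 d`. This saves one
factor `d` and is why a random letter must be present. -/
theorem integral_norm_trace_hybridProd_mul_sq_le (hσ : IsDensityMatrix σ) (S : Finset (Fin n))
    {l : List (Fin n)} (hl : l.Nodup) (hS : 0 < l.countP (· ∈ S)) (a : ℕ) :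
    ∫ u, ‖(σ ^ a * hybridProd σ S l u).trace‖ ^ 2 ∂(outcomeLaw n σ) ≤
      3 * (3 * d) ^ (l.countP (· ∈ S) - 1) * ‖σ ^ (a + l.countP (· ∉ S))‖ ^ 2 := by
  have := hσ.neZero
  have := hσ.isProbabilityMeasure_uniformPOVM
  have hp : IsProbabilityMeasure (outcomeLaw n σ) := by unfold outcomeLaw; infer_instance
  induction l generalizing a with
  | nil => simp at hS
  | cons i l ih =>
    have hil : i ∉ l := (List.nodup_cons.mp hl).1
    by_cases hi : i ∈ S
    · rw [List.countP_cons_of_pos (by simpa using hi),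
        List.countP_cons_of_neg (by simpa using hi), Nat.add_sub_cancel]
      have hc := continuous_hybridProd (d := d) σ S l
      have hc' := continuous_hybridProd (d := d) σ S (i :: l)
      have hstep : ∫ u, ‖(σ ^ a * hybridProd σ S (i :: l) u).trace‖ ^ 2 ∂(outcomeLaw n σ) ≤
          ∫ u, 3 * ‖σ ^ 0 * hybridProd σ S l u * σ ^ a‖ ^ 2 ∂(outcomeLaw n σ) := by
        unfold outcomeLaw
        rw [integral_pi_eq_integral_update _ i (continuous_integrable (by fun_prop))]
        refine integral_mono_of_nonneg (Filter.Eventually.of_forall fun u =>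
          integral_nonneg fun v => by positivity) (continuous_integrable (by fun_prop))
          (Filter.Eventually.of_forall fun u => ?_)
        simp only [hybridProd_cons, hybridProd_update_of_notMem σ hil, pow_zero, one_mul]
        have e1 : ∀ v, hybridEstimator σ S (Function.update u i v) i = stateEstimator v :=
          fun v => by simp [hybridEstimator, hi]
        simp only [e1, Matrix.trace_mul_comm (σ ^ a), mul_assoc]
        exact integral_norm_trace_sq_le hσ _
      refine hstep.trans ?_
      rw [integral_const_mul, mul_assoc]
      have h0 := integral_norm_mul_hybridProd_mul_sq_le hσ S (List.nodup_cons.mp hl).2 0 a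
      rw [zero_add] at h0
      gcongr
    · rw [List.countP_cons_of_neg (by simpa using hi)] at hS
      rw [List.countP_cons_of_neg (by simpa using hi),
        List.countP_cons_of_pos (by simpa using hi)]
      have e1 : ∀ u : Fin n → UnitVector d, hybridEstimator σ S u i = σ :=
        fun u => by simp [hybridEstimator, hi]
      simp only [hybridProd_cons, e1, ← mul_assoc, ← pow_succ]
      refine (ih (List.nodup_cons.mp hl).2 hS (a + 1)).trans (le_of_eq ?_)
      congr 4
      ring

end Hybrid

/-! ### Counting index sequences by overlap, and binomial estimates. -/

section Counting

theorem sum_embedding_eq_sum_powersetCard {α : Type*} [AddCommMonoid α] (n k : ℕ)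
    (f : Finset (Fin n) → α) :
    ∑ κ : Fin k ↪ Fin n, f (Finset.univ.map κ) =
      k.factorial • ∑ T ∈ Finset.powersetCard k Finset.univ, f T := by
  have hmaps : ∀ κ ∈ (Finset.univ : Finset (Fin k ↪ Fin n)),
      Finset.univ.map κ ∈ Finset.powersetCard k (Finset.univ : Finset (Fin n)) := fun κ _ => by
    simp [Finset.mem_powersetCard]
  rw [← Finset.sum_fiberwise_of_maps_to hmaps, Finset.smul_sum]
  refine Finset.sum_congr rfl fun T hT => ?_
  have hTk : T.card = k := (Finset.mem_powersetCard.mp hT).2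
  rw [Finset.sum_congr rfl fun κ hκ => by rw [(Finset.mem_filter.mp hκ).2], Finset.sum_const]
  congr 1
  have himg : Finset.univ.filter (fun κ : Fin k ↪ Fin n => Finset.univ.map κ = T) =
      Finset.univ.image fun e : Fin k ↪ T => e.trans (Function.Embedding.subtype _) := by
    ext κ
    simp only [Finset.mem_filter, Finset.mem_univ, true_and, Finset.mem_image]
    constructor
    · rintro rfl
      exact ⟨⟨fun j => ⟨κ j, by simp⟩, fun a b h => κ.injective (congrArg Subtype.val h)⟩, rfl⟩
    · rintro ⟨e, rfl⟩
      refine Finset.eq_of_subset_of_card_le (fun x hx => ?_) (by simp [hTk])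
      obtain ⟨j, -, rfl⟩ := Finset.mem_map.mp hx
      exact (e j).2
  rw [himg, Finset.card_image_of_injective]
  · simp [Fintype.card_embedding_eq, hTk, Nat.descFactorial_self]
  · intro e e' h
    ext j
    exact congrArg Fin.val (DFunLike.congr_fun h j)

theorem card_powersetCard_filter_inter {n k m : ℕ} (hm : m ≤ k) {R : Finset (Fin n)}
    (hR : R.card = k) :
    ((Finset.powersetCard k Finset.univ).filter fun T => (R ∩ T).card = m).card =
      k.choose m * (n - k).choose (k - m) := by
  have hRc : Rᶜ.card = n - k := by rw [Finset.card_compl, hR, Fintype.card_fin]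
  rw [← hRc, ← Finset.card_powersetCard (k - m) Rᶜ]
  conv_rhs => rw [← hR, ← Finset.card_powersetCard m R, hR, ← Finset.card_product]
  refine Finset.card_nbij' (fun T => (R ∩ T, Rᶜ ∩ T)) (fun p => p.1 ∪ p.2) ?_ ?_ ?_ ?_
  · intro T hT
    obtain ⟨hT, hTm⟩ := Finset.mem_filter.mp hT
    have hTk := (Finset.mem_powersetCard.mp hT).2
    have hsplit : (R ∩ T).card + (Rᶜ ∩ T).card = T.card := by
      rw [← Finset.card_union_of_disjoint]
      · rw [← Finset.union_inter_distrib_right]; simp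
      · exact (disjoint_compl_right).mono Finset.inter_subset_left Finset.inter_subset_left
    simp only [Finset.coe_product, Set.mem_prod, Finset.mem_coe, Finset.mem_powersetCard]
    exact ⟨⟨Finset.inter_subset_left, hTm⟩, Finset.inter_subset_left, by omega⟩
  · rintro ⟨A, B⟩ hp
    simp only [Finset.coe_product, Set.mem_prod, Finset.mem_coe, Finset.mem_powersetCard] at hp
    obtain ⟨⟨hA, hAm⟩, hB, hBm⟩ := hp
    have hAB : Disjoint A B := disjoint_compl_right.mono hA hB
    have hRB : R ∩ B = ∅ := Finset.disjoint_iff_inter_eq_empty.mp (disjoint_compl_right.mono_right hB)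
    simp only [Finset.coe_filter, Set.mem_ofPred_eq, Finset.mem_powersetCard, Finset.subset_univ,
      true_and]
    rw [Finset.card_union_of_disjoint hAB, Finset.inter_union_distrib_left, hRB,
      Finset.inter_eq_right.mpr hA, Finset.union_empty]
    omega
  · intro T _
    simp only
    rw [← Finset.union_inter_distrib_right]; simp
  · rintro ⟨A, B⟩ hp
    simp only [Finset.coe_product, Set.mem_prod, Finset.mem_coe, Finset.mem_powersetCard] at hp
    obtain ⟨⟨hA, -⟩, hB, -⟩ := hp
    have hRB : R ∩ B = ∅ := Finset.disjoint_iff_inter_eq_empty.mp (disjoint_compl_right.mono_right hB)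
    have hRA : Rᶜ ∩ A = ∅ := Finset.disjoint_iff_inter_eq_empty.mp (disjoint_compl_left.mono_right hA)
    simp only [Finset.inter_union_distrib_left, hRB, hRA, Finset.inter_eq_right.mpr hA,
      Finset.inter_eq_right.mpr hB, Finset.union_empty, Finset.empty_union]

/-- Summing a function of the overlap with a fixed `k`-subset over all injective sequences. -/
theorem sum_embedding_card_inter {n k : ℕ} {R : Finset (Fin n)} (hR : R.card = k) (f : ℕ → ℝ)
    (hf : f 0 = 0) :
    ∑ κ : Fin k ↪ Fin n, f (R ∩ Finset.univ.map κ).card =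
      k.factorial * ∑ i ∈ Finset.range k,
        (k.choose (k - i) : ℝ) * ((n - k).choose i : ℝ) * f (k - i) := by
  rw [sum_embedding_eq_sum_powersetCard n k fun T => f (R ∩ T).card, nsmul_eq_mul]
  congr 1
  have hmaps : ∀ T ∈ Finset.powersetCard k (Finset.univ : Finset (Fin n)),
      (R ∩ T).card ∈ Finset.range (k + 1) := fun T _ => by
    rw [Finset.mem_range, Nat.lt_succ_iff, ← hR]
    exact Finset.card_le_card Finset.inter_subset_left
  have hterm : ∀ m ∈ Finset.range (k + 1),
      ∑ T ∈ (Finset.powersetCard k Finset.univ).filter (fun T => (R ∩ T).card = m),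
        f (R ∩ T).card = (k.choose m : ℝ) * ((n - k).choose (k - m) : ℝ) * f m := fun m hm => by
    rw [Finset.sum_congr rfl fun T hT => by rw [(Finset.mem_filter.mp hT).2], Finset.sum_const,
      card_powersetCard_filter_inter (Nat.lt_succ_iff.mp (Finset.mem_range.mp hm)) hR, nsmul_eq_mul]
    push_cast
    ring
  -- The overlap runs over `0, …, k`; the term at `0` vanishes by `hf`, and reversing the rest makes
  -- `i` the number of unshared indices, with overlap `k - i`.
  rw [← Finset.sum_fiberwise_of_maps_to hmaps, Finset.sum_congr rfl hterm, Finset.sum_range_succ',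
    hf, mul_zero, add_zero, ← Finset.sum_range_reflect]
  refine Finset.sum_congr rfl fun i hi => ?_
  have hi := Finset.mem_range.mp hi
  rw [show k - 1 - i + 1 = k - i by omega, show k - (k - i) = i by omega]

/-- Descending from `k` to `j`, each consecutive ratio is `(t + 1) / (n - t)`, at most `2 k / n`
because `t + 1 ≤ k ≤ n / 2`. -/
theorem choose_le_mul_choose {n k j : ℕ} (hk : 1 ≤ k) (hkn : 2 * k ≤ n) (hj : j ≤ k) :
    (n.choose j : ℝ) ≤ (2 * k / n : ℝ) ^ (k - j) * n.choose k := by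
  induction hj using Nat.decreasingInduction with
  | self => simp
  | of_succ t ht ih =>
    have hn : (0 : ℝ) < n := by exact_mod_cast (by omega : 0 < n)
    have h1 : (n.choose (t + 1) : ℝ) * (t + 1) = n.choose t * (n - t) := by
      have := Nat.choose_succ_right_eq n t
      have h2 : ((n - t : ℕ) : ℝ) = n - t := Nat.cast_sub (by omega)
      rw [← h2]
      exact_mod_cast this
    have ht1 : (t : ℝ) + 1 ≤ k := by exact_mod_cast ht
    have hkn' : 2 * (k : ℝ) ≤ n := by exact_mod_cast hkn
    have hstep : (n.choose t : ℝ) ≤ (2 * k / n) * n.choose (t + 1) := by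
      rw [div_mul_eq_mul_div, le_div_iff₀ hn]
      have ha : (0 : ℝ) ≤ n.choose t := Nat.cast_nonneg _
      have hb : (0 : ℝ) ≤ n.choose (t + 1) := Nat.cast_nonneg _
      nlinarith [mul_le_mul_of_nonneg_left ht1 hb,
        mul_le_mul_of_nonneg_left (by linarith : (n : ℝ) ≤ 2 * (n - t)) ha]
    refine hstep.trans ((mul_le_mul_of_nonneg_left ih (by positivity)).trans (le_of_eq ?_))
    rw [← mul_assoc, ← pow_succ', show k - (t + 1) + 1 = k - t by omega]

theorem choose_mul_choose_div_choose_le {n k j : ℕ} (hk : 1 ≤ k) (hkn : 2 * k ≤ n) (hj : j ≤ k) :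
    1 / (n.choose k : ℝ) * ((k.choose (k - j) : ℝ) * ((n - k).choose j : ℝ)) ≤
      4 ^ k * (k / n : ℝ) ^ (k - j) := by
  have hpos : (0 : ℝ) < n.choose k := by exact_mod_cast Nat.choose_pos (by omega)
  rw [one_div_mul_eq_div, div_le_iff₀ hpos]
  have h1 : (k.choose (k - j) : ℝ) ≤ 2 ^ k := by exact_mod_cast Nat.choose_le_two_pow k (k - j)
  have h2 : ((n - k).choose j : ℝ) ≤ n.choose j := by
    exact_mod_cast Nat.choose_le_choose j (Nat.sub_le n k)
  have h3 := choose_le_mul_choose hk hkn hj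
  have h4 : (2 * k / n : ℝ) ^ (k - j) ≤ 2 ^ k * (k / n : ℝ) ^ (k - j) := by
    rw [mul_div_assoc, mul_pow]
    gcongr
    · norm_num
    · omega
  -- The `4 ^ k` is one `2 ^ k` from `k.choose (k - j)` and one from the factors `2` in `(2 * k / n)
  -- ^ (k - j)`.
  calc (k.choose (k - j) : ℝ) * ((n - k).choose j : ℝ)
      ≤ 2 ^ k * ((2 ^ k * (k / n : ℝ) ^ (k - j)) * n.choose k) := by
        gcongr
        exact h2.trans (h3.trans (by gcongr))
    _ = 4 ^ k * (k / n : ℝ) ^ (k - j) * n.choose k := by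
        rw [show (4 : ℝ) = 2 * 2 by norm_num, mul_pow]; ring

end Counting

/-! ### Realness, unbiasedness and variance of the moment estimator. -/

section Moment

variable {d n k : ℕ} {σ : Matrix (Fin d) (Fin d) ℂ}

/-- The covariance of two summands is controlled by the number of shared positions. -/
theorem covariance_trace_hybridProd_le (hσ : IsDensityMatrix σ) {l l' : List (Fin n)}
    (hl : l.Nodup) (hl' : l'.Nodup) (hlk : l.length = k) (hlk' : l'.length = k) :
    (∫ u, (hybridProd σ Finset.univ l u).trace * (hybridProd σ Finset.univ l' u).trace
        ∂(outcomeLaw n σ)).re - ((σ ^ k).trace.re) ^ 2 ≤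
      if (l.toFinset ∩ l'.toFinset).card = 0 then 0 else
        6 ^ k * (d : ℝ) ^ ((l.toFinset ∩ l'.toFinset).card - 1) *
          ((σ ^ (2 * (k - (l.toFinset ∩ l'.toFinset).card))).trace).re := by
  have := hσ.neZero
  have := hσ.isProbabilityMeasure_uniformPOVM
  have hp : IsProbabilityMeasure (outcomeLaw n σ) := by unfold outcomeLaw; infer_instance
  have hcount : ∀ {s t : List (Fin n)}, s.Nodup →
      s.countP (· ∈ t.toFinset) = (s.toFinset ∩ t.toFinset).card := fun {s t} hs => by
    rw [List.countP_eq_length_filter, ← List.toFinset_card_of_nodup (hs.filter _),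
      List.toFinset_filter]
    congr 1
    ext x
    simp
  rw [integral_trace_mul_trace hσ hl hl']
  split_ifs with h0
  · have hdis : Disjoint l.toFinset l'.toFinset :=
      Finset.disjoint_iff_inter_eq_empty.mpr (Finset.card_eq_zero.mp h0)
    have e1 : ∀ u, hybridProd σ l'.toFinset l u = σ ^ k := fun u => by
      rw [hybridProd_of_disjoint σ (fun i hi h => Finset.disjoint_left.mp hdis
        (List.mem_toFinset.mpr hi) h), hlk]
    have e2 : ∀ u, hybridProd σ l.toFinset l' u = σ ^ k := fun u => by
      rw [hybridProd_of_disjoint σ (fun i hi h => Finset.disjoint_left.mp hdis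
        h (List.mem_toFinset.mpr hi)), hlk']
    simp only [e1, e2, integral_const, probReal_univ, one_smul,
      trace_pow_of_isHermitian hσ.1.1, ← Complex.ofReal_mul, Complex.ofReal_re]
    exact le_of_eq (by ring)
  · have hm := Nat.pos_of_ne_zero h0
    have key : ∀ {s t : List (Fin n)}, s.Nodup → s.length = k →
        (s.toFinset ∩ t.toFinset).card = (l.toFinset ∩ l'.toFinset).card →
        ∫ u, ‖(hybridProd σ t.toFinset s u).trace‖ ^ 2 ∂(outcomeLaw n σ) ≤
          6 ^ k * (d : ℝ) ^ ((l.toFinset ∩ l'.toFinset).card - 1) *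
          ((σ ^ (2 * (k - (l.toFinset ∩ l'.toFinset).card))).trace).re := fun {s t} hs hsk hst => by
      have h := integral_norm_trace_hybridProd_mul_sq_le hσ t.toFinset hs
        (by rw [hcount hs, hst]; exact hm) 0
      have hneg : s.countP (· ∉ t.toFinset) = k - (l.toFinset ∩ l'.toFinset).card := by
        have h1 := List.length_eq_countP_add_countP (fun x => decide (x ∈ t.toFinset)) (l := s)
        have h2 := hcount (t := t) hs
        have h3 : s.countP (fun a => decide ¬(decide (a ∈ t.toFinset) = true)) =
          s.countP (· ∉ t.toFinset) := by simp
        omega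
      simp only [pow_zero, one_mul, zero_add, hcount hs, hst, hneg] at h
      rw [norm_sq_pow_of_isHermitian hσ.1.1] at h
      have hmk : (l.toFinset ∩ l'.toFinset).card ≤ k := by
        rw [← hst, ← hsk, ← List.toFinset_card_of_nodup hs]
        exact Finset.card_le_card Finset.inter_subset_left
      set m := (l.toFinset ∩ l'.toFinset).card
      have hnn : 0 ≤ ((σ ^ (2 * (k - m))).trace).re := by
        rw [← norm_sq_pow_of_isHermitian hσ.1.1]; positivity
      refine h.trans (mul_le_mul_of_nonneg_right ?_ hnn)
      rw [mul_pow, ← mul_assoc, ← pow_succ', Nat.sub_add_cancel hm]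
      -- The argument gives the constant `3 ^ m`; it is relaxed to `6 ^ k`, uniform in the overlap.
      have h36 : (3 : ℝ) ^ m ≤ 6 ^ k :=
        (pow_le_pow_left₀ (by norm_num) (by norm_num) m).trans
          (pow_le_pow_right₀ (by norm_num) hmk)
      gcongr
    have k1 := key (t := l') hl hlk rfl
    have k2 := key (t := l) hl' hlk' (by rw [Finset.inter_comm])
    have c1 := continuous_hybridProd (d := d) σ l'.toFinset l
    have c2 := continuous_hybridProd (d := d) σ l.toFinset l'
    -- The shared letters may occur in different orders in the two words, so the product is split by
    -- the arithmetic-geometric mean inequality and each word is bounded on its own.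
    have hnorm : (∫ u, (hybridProd σ l'.toFinset l u).trace * (hybridProd σ l.toFinset l' u).trace
        ∂(outcomeLaw n σ)).re ≤
        ∫ u, (‖(hybridProd σ l'.toFinset l u).trace‖ ^ 2 / 2 +
          ‖(hybridProd σ l.toFinset l' u).trace‖ ^ 2 / 2) ∂(outcomeLaw n σ) := by
      refine (Complex.re_le_norm _).trans (norm_integral_le_of_norm_le
        (continuous_integrable (by fun_prop)) (Filter.Eventually.of_forall fun u => ?_))
      rw [norm_mul]
      linarith [two_mul_le_add_sq ‖(hybridProd σ l'.toFinset l u).trace‖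
        ‖(hybridProd σ l.toFinset l' u).trace‖]
    rw [integral_add (continuous_integrable (by fun_prop)) (continuous_integrable (by fun_prop)),
      integral_div, integral_div] at hnorm
    linarith [sq_nonneg ((σ ^ k).trace.re)]

theorem momentEstimator_eq_sum (σ : Matrix (Fin d) (Fin d) ℂ) (n k : ℕ)
    (u : Fin n → UnitVector d) :
    momentEstimator n k u = (n.descFactorial k : ℂ)⁻¹ *
      ∑ i : Fin k ↪ Fin n, (hybridProd σ Finset.univ (List.ofFn i) u).trace := by
  simp only [momentEstimator, hybridProd, List.map_ofFn]
  congr 1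
  refine Finset.sum_congr rfl fun i _ => ?_
  congr 3
  funext j
  simp [hybridEstimator]

theorem momentEstimator_im (n k : ℕ) (u : Fin n → UnitVector d) :
    (momentEstimator n k u).im = 0 := by
  rw [← Complex.conj_eq_iff_im, momentEstimator, map_mul, map_inv₀, Complex.conj_natCast, map_sum]
  congr 1
  -- Conjugating the trace of a product of Hermitian matrices reverses the order of the factors, and
  -- reversal permutes the injective sequences; only the full sum is claimed to be real.
  rw [← (Equiv.embeddingCongr (Fin.revPerm (n := k)) (Equiv.refl (Fin n))).sum_comp]
  refine Finset.sum_congr rfl fun i _ => ?_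
  rw [starRingEnd_apply, ← Matrix.trace_conjTranspose, Matrix.conjTranspose_list_prod,
    List.map_ofFn]
  congr 2
  apply List.ext_getElem
  · simp
  · intro m h1 h2
    have hmk : m < k := by simpa using h2
    simp only [List.getElem_reverse, List.getElem_ofFn, Function.comp_apply, List.length_ofFn,
      conjTranspose_stateEstimator]
    congr 2
    simp only [Equiv.embeddingCongr, Equiv.coe_fn_mk]
    simp
    ext
    simp [Fin.val_rev]
    omega

theorem continuous_momentEstimator (n k : ℕ) :
    Continuous (momentEstimator (d := d) n k) := by
  -- Every position is random here, so the mean inserted elsewhere is irrelevant and `0` serves.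
  have h : momentEstimator (d := d) n k = _ := funext (momentEstimator_eq_sum 0 n k)
  rw [h]
  exact continuous_const.mul (continuous_finsetSum _ fun i _ =>
    (continuous_hybridProd 0 _ _).matrix_trace)

theorem isProbabilityMeasure_outcomeLaw (hσ : IsDensityMatrix σ) (n : ℕ) :
    IsProbabilityMeasure (outcomeLaw n σ) := by
  have := hσ.neZero
  have := hσ.isProbabilityMeasure_uniformPOVM
  unfold outcomeLaw
  infer_instance

theorem nodup_ofFn (i : Fin k ↪ Fin n) : (List.ofFn i).Nodup := List.nodup_ofFn.mpr i.injective

theorem integral_momentEstimator (hσ : IsDensityMatrix σ) (hkn : k ≤ n) :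
    ∫ u, momentEstimator n k u ∂(outcomeLaw n σ) = (σ ^ k).trace := by
  have := isProbabilityMeasure_outcomeLaw hσ n
  simp only [momentEstimator_eq_sum σ]
  rw [integral_const_mul, integral_finsetSum _ fun i _ =>
    continuous_integrable (continuous_hybridProd σ _ _).matrix_trace]
  simp only [integral_trace_hybridProd hσ _ (nodup_ofFn _), List.length_ofFn, Finset.sum_const,
    Finset.card_univ, Fintype.card_embedding_eq, Fintype.card_fin, nsmul_eq_mul]
  have hN : (n.descFactorial k : ℂ) ≠ 0 := by
    exact_mod_cast (Nat.descFactorial_pos.mpr hkn).ne'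
  field_simp

theorem integral_momentEstimator_re (hσ : IsDensityMatrix σ) (hkn : k ≤ n) :
    ∫ u, (momentEstimator n k u).re ∂(outcomeLaw n σ) = ((σ ^ k).trace).re := by
  have := isProbabilityMeasure_outcomeLaw hσ n
  rw [← integral_momentEstimator hσ hkn]
  exact integral_re (continuous_integrable (continuous_momentEstimator n k))

theorem memLp_momentEstimator_re (hσ : IsDensityMatrix σ) :
    MemLp (fun u => (momentEstimator n k u).re) 2 (outcomeLaw n σ) := by
  have := isProbabilityMeasure_outcomeLaw hσ n
  exact (Complex.continuous_re.comp (continuous_momentEstimator n k)).memLp_of_hasCompactSupport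
    (HasCompactSupport.of_compactSpace _)

theorem variance_momentEstimator_eq (hσ : IsDensityMatrix σ) (hkn : k ≤ n) :
    ProbabilityTheory.variance (fun u => (momentEstimator n k u).re) (outcomeLaw n σ) =
      ((n.descFactorial k : ℝ)⁻¹) ^ 2 * ∑ i : Fin k ↪ Fin n, ∑ j : Fin k ↪ Fin n,
        ((∫ u, (hybridProd σ Finset.univ (List.ofFn i) u).trace *
          (hybridProd σ Finset.univ (List.ofFn j) u).trace ∂(outcomeLaw n σ)).re
          - ((σ ^ k).trace.re) ^ 2) := by
  have := isProbabilityMeasure_outcomeLaw hσ n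
  rw [ProbabilityTheory.variance_eq_sub (memLp_momentEstimator_re hσ),
    integral_momentEstimator_re hσ hkn]
  have hN : (n.descFactorial k : ℝ) ≠ 0 := by
    exact_mod_cast (Nat.descFactorial_pos.mpr hkn).ne'
  -- Realness lets the square be taken without conjugation, so it expands into products of the
  -- complex traces themselves.
  have hsq : ∀ u, ((fun u : Fin n → UnitVector d => (momentEstimator n k u).re) ^ 2) u =
      (momentEstimator n k u * momentEstimator n k u).re := fun u => by
    simp [momentEstimator_im, sq]
  simp only [hsq]
  have hre : ∫ u, (momentEstimator n k u * momentEstimator n k u).re ∂(outcomeLaw n σ) =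
      (∫ u, momentEstimator n k u * momentEstimator n k u ∂(outcomeLaw n σ)).re :=
    integral_re (continuous_integrable
      ((continuous_momentEstimator n k).mul (continuous_momentEstimator n k)))
  have hexp : ∀ u : Fin n → UnitVector d, momentEstimator n k u * momentEstimator n k u =
      (((n.descFactorial k : ℝ)⁻¹ ^ 2 : ℝ) : ℂ) * ∑ i : Fin k ↪ Fin n, ∑ j : Fin k ↪ Fin n,
        (hybridProd σ Finset.univ (List.ofFn i) u).trace *
          (hybridProd σ Finset.univ (List.ofFn j) u).trace := fun u => by
    rw [momentEstimator_eq_sum σ, mul_mul_mul_comm, Finset.sum_mul_sum]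
    push_cast
    ring
  have hint : ∀ i j : Fin k ↪ Fin n, Integrable (fun u : Fin n → UnitVector d =>
      (hybridProd σ Finset.univ (List.ofFn i) u).trace *
        (hybridProd σ Finset.univ (List.ofFn j) u).trace) (outcomeLaw n σ) := fun i j =>
    continuous_integrable ((continuous_hybridProd σ _ _).matrix_trace.mul
      (continuous_hybridProd σ _ _).matrix_trace)
  rw [hre]
  simp only [hexp]
  rw [integral_const_mul, Complex.re_ofReal_mul,
    integral_finsetSum _ fun i _ => integrable_finsetSum _ fun j _ => hint i j]
  simp only [integral_finsetSum _ fun j _ => hint _ j, Complex.re_sum, Finset.sum_sub_distrib,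
    Finset.sum_const, Finset.card_univ, Fintype.card_embedding_eq, Fintype.card_fin, nsmul_eq_mul]
  field_simp

theorem variance_momentEstimator_le (hσ : IsDensityMatrix σ) (hkn : k ≤ n) :
    ProbabilityTheory.variance (fun u => (momentEstimator n k u).re) (outcomeLaw n σ) ≤
      (1 / (n.choose k : ℝ)) *
          ∑ i ∈ Finset.range k,
            (k.choose (k - i) : ℝ) * ((n - k).choose i : ℝ) * 6 ^ k * (d : ℝ) ^ (k - i - 1) *
              ((σ ^ (2 * i)).trace).re := by
  rw [variance_momentEstimator_eq hσ hkn]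
  let f : ℕ → ℝ := fun m => if m = 0 then 0 else
    6 ^ k * (d : ℝ) ^ (m - 1) * ((σ ^ (2 * (k - m))).trace).re
  have hfin : ∀ i : Fin k ↪ Fin n, (List.ofFn i).toFinset = Finset.univ.map i := fun i => by
    ext x
    simp [List.mem_ofFn]
  have hbound : ∀ i : Fin k ↪ Fin n, ∑ j : Fin k ↪ Fin n,
        ((∫ u, (hybridProd σ Finset.univ (List.ofFn i) u).trace *
          (hybridProd σ Finset.univ (List.ofFn j) u).trace ∂(outcomeLaw n σ)).re
          - ((σ ^ k).trace.re) ^ 2) ≤ k.factorial * ∑ i ∈ Finset.range k,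
        (k.choose (k - i) : ℝ) * ((n - k).choose i : ℝ) * f (k - i) := fun i => by
    rw [← sum_embedding_card_inter (R := Finset.univ.map i) (by simp) f (if_pos rfl)]
    refine Finset.sum_le_sum fun j _ => ?_
    rw [← hfin, ← hfin]
    exact covariance_trace_hybridProd_le hσ (nodup_ofFn i) (nodup_ofFn j) (by simp) (by simp)
  have hN : (0 : ℝ) < n.descFactorial k := by exact_mod_cast Nat.descFactorial_pos.mpr hkn
  refine (mul_le_mul_of_nonneg_left (Finset.sum_le_sum fun i _ => hbound i)
    (by positivity)).trans (le_of_eq ?_)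
  rw [Finset.sum_const, Finset.card_univ, Fintype.card_embedding_eq, Fintype.card_fin,
    Fintype.card_fin, nsmul_eq_mul]
  have hch : (n.descFactorial k : ℝ) = k.factorial * n.choose k := by
    exact_mod_cast Nat.descFactorial_eq_factorial_mul_choose n k
  have hsum : ∑ i ∈ Finset.range k, (k.choose (k - i) : ℝ) * ((n - k).choose i : ℝ) * f (k - i) =
      ∑ i ∈ Finset.range k, (k.choose (k - i) : ℝ) * ((n - k).choose i : ℝ) * 6 ^ k *
        (d : ℝ) ^ (k - i - 1) * ((σ ^ (2 * i)).trace).re := by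
    refine Finset.sum_congr rfl fun i hi => ?_
    have hi := Finset.mem_range.mp hi
    simp only [f]
    rw [if_neg (by omega), show k - (k - i) = i by omega]
    ring
  rw [hsum, hch]
  have h1 : (k.factorial : ℝ) ≠ 0 := by exact_mod_cast k.factorial_ne_zero
  have h2 : (n.choose k : ℝ) ≠ 0 := by exact_mod_cast (Nat.choose_pos hkn).ne'
  have h3 : ∀ s : ℝ, ((k.factorial : ℝ) * n.choose k)⁻¹ ^ 2 *
      (k.factorial * n.choose k * (k.factorial * s)) = 1 / n.choose k * s := fun s => by
    field_simp
  exact h3 _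

theorem variance_momentEstimator_le_of_two_mul_le (hσ : IsDensityMatrix σ) (hk : 1 ≤ k)
    (hkn : 2 * k ≤ n) :
    ProbabilityTheory.variance (fun u => (momentEstimator n k u).re) (outcomeLaw n σ) ≤
      (24 ^ k / (d : ℝ)) *
            ∑ j ∈ Finset.range k,
              ((k : ℝ) * (d : ℝ) / (n : ℝ)) ^ (k - j) * ((σ ^ (2 * j)).trace).re := by
  refine (variance_momentEstimator_le hσ (by omega)).trans ?_
  rw [Finset.mul_sum, Finset.mul_sum]
  refine Finset.sum_le_sum fun j hj => ?_
  have hj := Finset.mem_range.mp hj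
  have hd : (d : ℝ) ≠ 0 := by exact_mod_cast hσ.neZero.out
  have hnn : 0 ≤ ((σ ^ (2 * j)).trace).re := by
    rw [← norm_sq_pow_of_isHermitian hσ.1.1]; positivity
  have h := choose_mul_choose_div_choose_le hk hkn hj.le
  calc _ = (1 / (n.choose k : ℝ) * ((k.choose (k - j) : ℝ) * ((n - k).choose j : ℝ))) *
        (6 ^ k * (d : ℝ) ^ (k - j - 1) * ((σ ^ (2 * j)).trace).re) := by ring
    _ ≤ 4 ^ k * (k / n : ℝ) ^ (k - j) *
        (6 ^ k * (d : ℝ) ^ (k - j - 1) * ((σ ^ (2 * j)).trace).re) := by gcongr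
    _ = _ := by
      -- Since `j < k`, the truncated exponent satisfies `d ^ (k - j - 1) = d ^ (k - j) / d`; this
      -- is the source of the prefactor `1 / d`.
      obtain ⟨m, hm⟩ : ∃ m, k - j = m + 1 := ⟨k - j - 1, by omega⟩
      rw [hm, Nat.add_sub_cancel, mul_div_right_comm, mul_pow (k / n : ℝ),
        show (24 : ℝ) = 4 * 6 by norm_num, mul_pow (4 : ℝ), pow_succ (d : ℝ)]
      field_simp

end Moment

end QuantumMoment

theorem theorem5p2 (d n k : ℕ) (hk : 1 ≤ k) (hkn : k ≤ n)
    (σ : Matrix (Fin d) (Fin d) ℂ) (hσ : QuantumMoment.IsDensityMatrix σ) :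
    -- the outcome law is a probability measure, and `Z_k` is a real-valued, square-integrable,
    -- unbiased estimator of the `k`-th moment
    IsProbabilityMeasure (QuantumMoment.outcomeLaw n σ) ∧
    (∀ u : Fin n → QuantumMoment.UnitVector d, (QuantumMoment.momentEstimator n k u).im = 0) ∧
    MemLp (fun u => (QuantumMoment.momentEstimator n k u).re) 2 (QuantumMoment.outcomeLaw n σ) ∧
    ∫ u, (QuantumMoment.momentEstimator n k u).re ∂(QuantumMoment.outcomeLaw n σ)
      = ((σ ^ k).trace).re ∧
    -- the finer variance bound
    ProbabilityTheory.variance (fun u => (QuantumMoment.momentEstimator n k u).re)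
        (QuantumMoment.outcomeLaw n σ)
      ≤ (1 / (n.choose k : ℝ)) *
          ∑ i ∈ Finset.range k,
            (k.choose (k - i) : ℝ) * ((n - k).choose i : ℝ) * 6 ^ k * (d : ℝ) ^ (k - i - 1) *
              ((σ ^ (2 * i)).trace).re ∧
    -- the main variance bound
    (2 * k ≤ n →
      ProbabilityTheory.variance (fun u => (QuantumMoment.momentEstimator n k u).re)
          (QuantumMoment.outcomeLaw n σ)
        ≤ (24 ^ k / (d : ℝ)) *
            ∑ j ∈ Finset.range k,
              ((k : ℝ) * (d : ℝ) / (n : ℝ)) ^ (k - j) * ((σ ^ (2 * j)).trace).re) := by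
  refine ⟨QuantumMoment.isProbabilityMeasure_outcomeLaw hσ n,
    QuantumMoment.momentEstimator_im n k, QuantumMoment.memLp_momentEstimator_re hσ,
    QuantumMoment.integral_momentEstimator_re hσ hkn,
    QuantumMoment.variance_momentEstimator_le hσ hkn,
    QuantumMoment.variance_momentEstimator_le_of_two_mul_le hσ hk⟩
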